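/- **Setting.** Let $\omega\in\mathbb C$ with $\operatorname{Im}\omega>0$, let $\mathsf N\ge 0$, and let $\eta,\zeta,\kappa,\tau,\xi_1,\dots,\xi_{\mathsf N}\in\mathbb C$. Let $\theta_j(u|x)$ be the Jacobi theta functions with nome $e^{i\pi x}$, e.g. $\theta_3(u|x)=\sum_{n\in\mathbb Z}e^{i\pi x n^2}e^{2inu}$; assume $\theta_1(\zeta|2\omega)\neq0$, and write $\theta(u)=\theta_1(u|\omega)$, and below $\theta_j(u)=\theta_j(u|2\omega)$ for $j=1,\dots,4$. Put $\rho=2/(\theta_2(0|\omega)\theta_4(0))$ and $$\mathrm a(\lambda)=\rho\,\theta_4(\eta)\theta_1(\lambda+\eta)\theta_4(\lambda),\quad \mathrm b(\lambda)=\rho\,\theta_4(\eta)\theta_1(\lambda)\theta_4(\lambda+\eta),$$ $$\mathrm c(\lambda)=\rho\,\theta_1(\eta)\theta_4(\lambda)\theta_4(\lambda+\eta),\quad \mathrm d(\lambda)=\rho\,\theta_1(\eta)\theta_1(\lambda+\eta)\theta_1(\lambda),$$ $$R(\lambda)=\begin{pmatrix}\mathrm a&0&0&\mathrm d\\0&\mathrm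 b&\mathrm c&0\\0&\mathrm c&\mathrm b&0\\\mathrm d&0&0&\mathrm a\end{pmatrix}(\lambda),\qquad p(\lambda)=\frac{2\theta_4(2\lambda+\eta)\theta_1(2\lambda-\eta)}{\theta_2(0|\omega)}.$$ Let $K(\lambda)$ be the $2\times2$ matrix with entries $$K_{11}(\lambda)=\frac{\theta_4(\zeta)\theta_4(\zeta-\lambda)\theta_1(\zeta+\lambda)}{\theta_1(\zeta)},\qquad K_{22}(\lambda)=\frac{\theta_4(\zeta)\theta_1(\zeta-\lambda)\theta_4(\zeta+\lambda)}{\theta_1(\zeta)},$$ $$K_{12}(\lambda)=\frac{\kappa e^{\tau}\theta_1(2\lambda)(\theta_4(\lambda)^2-e^{-2\tau}\theta_1(\lambda)^2)\theta_4(\zeta)^3}{\theta_1(\zeta)\theta_4(0)^2\theta_4(2\lambda)},\qquad K_{21}(\lambda)=\frac{\kappa e^{-\tau}\theta_1(2\lambda)(\theta_4(\lambda)^2-e^{2\tau}\theta_1(\lambda)^2)\theta_4(\zeta)^3}{\theta_1(\zeta)\theta_4(0)^2\theta_4(2\lambda)},$$ and $K_-(\lambda)=K(\lambda-\eta/2)=\begin{pmatrix}a_-(\lambda)&b_-(\lambda)\\c_-(\lambda)&d_-(\lambda)\end{pmatrix}$.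 On $\mathbb C^2_0\otimes\mathcal R_{\mathsf N}$, where $\mathcal R_{\mathsf N}=(\mathbb C^2)^{\otimes\mathsf N}$, put $$M(\lambda)=R_{0\mathsf N}(\lambda-\xi_{\mathsf N}-\tfrac\eta2)\cdots R_{01}(\lambda-\xi_1-\tfrac\eta2),\qquad \hat M(\lambda)=(-1)^{\mathsf N}\sigma_0^y\,M(-\lambda)^{t_0}\,\sigma_0^y,$$ $$\mathcal U_-(\lambda)=M(\lambda)K_-(\lambda)\hat M(\lambda)=\begin{pmatrix}\mathcal A_-(\lambda)&\mathcal B_-(\lambda)\\\mathcal C_-(\lambda)&\mathcal D_-(\lambda)\end{pmatrix},$$ where $t_0$ is the transpose in the space $0$, on which $K_-$ acts. Define the operator $\det_q\mathcal U_-(\lambda)\in\operatorname{End}(\mathcal R_{\mathsf N})$ by $\det_q\mathcal U_-(\lambda)=p(\lambda-\eta/2)\,Q(\lambda)$ with $$Q(\lambda)=\mathcal A_-(\lambda+\tfrac\eta2)\mathcal A_-(\tfrac\eta2-\lambda)+\mathcal B_-(\lambda+\tfrac\eta2)\mathcal C_-(\tfrac\eta2-\lambda).$$ Let $\sqrt k=\theta_2(0)/\theta_3(0)$,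 let $s(u)=\frac1{\sqrt k}\frac{\theta_1(u)}{\theta_4(u)}$ (that is, $\operatorname{sn}$ of modulus $k$ at $\theta_3(0)^2u$), and $h(\lambda)=\theta_4(\lambda+\zeta)\theta_4(\lambda-\zeta)$. For a fixed branch of the square root (any function $\sqrt{\cdot}$ on $\mathbb C$ with $(\sqrt z)^2=z$) let, with $x=\lambda-\eta/2$, $$g_-(\lambda)=\frac{h(x)}{s(\zeta)}\left(\sqrt{s(\zeta+x)\,s(\zeta-x)}+\kappa\, s(2x)\frac{\sqrt{(1-ke^{2\tau}s(x)^2)(1-ke^{-2\tau}s(x)^2)}}{1-k^2s(\zeta)^2s(x)^2}\right),$$ $$a(\lambda)=\prod_{n=1}^{\mathsf N}\theta(\lambda-\xi_n+\tfrac\eta2),\quad d(\lambda)=a(\lambda-\eta),\quad \hat{\mathsf A}_-(\lambda)=g_-(\lambda)a(\lambda)d(-\lambda).$$ **Proposition.** Each identity below is asserted at the spectral parameters at which its denominators do not vanish and at which the $\mathcal U_-(\cdot)$ (or off-diagonal entries of $K_-$) occurring in it have no pole, i.e. $\theta_4(2\mu-\eta)\ne0$ for each of their arguments $\mu$. 1.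 (Parity relations.) $$\mathcal A_-(\lambda)=\frac{\mathrm c(2\lambda)\mathcal D_-(\lambda)+p(\lambda)\mathcal D_-(-\lambda)}{\mathrm b(2\lambda)},\qquad \mathcal D_-(\lambda)=\frac{\mathrm c(2\lambda)\mathcal A_-(\lambda)+p(\lambda)\mathcal A_-(-\lambda)}{\mathrm b(2\lambda)},$$ $$\mathcal B_-(\lambda)=\frac{\mathrm a(2\lambda)\mathcal C_-(\lambda)+p(\lambda)\mathcal C_-(-\lambda)}{\mathrm d(2\lambda)},\qquad \mathcal C_-(\lambda)=\frac{\mathrm a(2\lambda)\mathcal B_-(\lambda)+p(\lambda)\mathcal B_-(-\lambda)}{\mathrm d(2\lambda)}.$$ 2. $$p(\lambda)=\frac{-\mathrm c(2\lambda)a_-(\lambda)+\mathrm b(2\lambda)d_-(\lambda)}{a_-(-\lambda)}=\frac{-\mathrm c(2\lambda)d_-(\lambda)+\mathrm b(2\lambda)a_-(\lambda)}{d_-(-\lambda)}$$ $$=\frac{-\mathrm a(2\lambda)b_-(\lambda)+\mathrm d(2\lambda)c_-(\lambda)}{b_-(-\lambda)}=\frac{-\mathrm a(2\lambda)c_-(\lambda)+\mathrm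 d(2\lambda)b_-(\lambda)}{c_-(-\lambda)}.$$ 3. For both $\epsilon=\pm1$, $$Q(\lambda)=\mathcal A_-(\epsilon\lambda+\tfrac\eta2)\mathcal A_-(\tfrac\eta2-\epsilon\lambda)+\mathcal B_-(\epsilon\lambda+\tfrac\eta2)\mathcal C_-(\tfrac\eta2-\epsilon\lambda)=\mathcal D_-(\epsilon\lambda+\tfrac\eta2)\mathcal D_-(\tfrac\eta2-\epsilon\lambda)+\mathcal C_-(\epsilon\lambda+\tfrac\eta2)\mathcal B_-(\tfrac\eta2-\epsilon\lambda).$$ 4. If $\det_q\mathcal U_-(\lambda)\neq0$, then $\det_q\mathcal U_-(\lambda)$ and $\mathcal U_-(\lambda+\eta/2)$ are invertible and $$\mathcal U_-^{-1}(\lambda+\eta/2)=\frac{p(\lambda-\eta/2)}{\det_q\mathcal U_-(\lambda)}\,\mathcal U_-(\eta/2-\lambda).$$ 5. The quantum determinant is central: $[\det_q\mathcal U_-(\lambda),\mathcal U_-(\mu)]=0$, i.e. it commutes with $\mathcal A_-(\mu),\mathcal B_-(\mu),\mathcal C_-(\mu),\mathcal D_-(\mu)$. 6. If moreover $\theta_4(\zeta)$,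 $\theta_4(\lambda)$, $\theta_4(\lambda+\zeta)$ and $\theta_4(\lambda-\zeta)$ do not vanish (so that $g_-(\pm\lambda+\eta/2)$ are defined), then $$\det{}_q\,\mathcal U_-(\lambda)=p(\lambda-\eta/2)\,\hat{\mathsf A}_-(\lambda+\eta/2)\,\hat{\mathsf A}_-(-\lambda+\eta/2)\cdot 1.$$ -/

import Mathlib

open scoped Kronecker

noncomputable section

namespace EightVertex

/-- `θ₃(u|τ) = ∑ q^{n²} e^{2inu}` with nome `q = e^{iπτ}`; Mathlib's `jacobiTheta₂` uses
the variable `u / π`. -/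
def theta3 (u τ : ℂ) : ℂ := jacobiTheta₂ (u / Real.pi) τ

/-- `θ₄(u|τ) = ∑ (-1)^n q^{n²} e^{2inu}`. -/
def theta4 (u τ : ℂ) : ℂ := jacobiTheta₂ (u / Real.pi + 1 / 2) τ

/-- `θ₂(u|τ) = ∑ q^{(n+1/2)²} e^{i(2n+1)u}`. -/
def theta2 (u τ : ℂ) : ℂ :=
  Complex.exp (Complex.I * Real.pi * τ / 4 + Complex.I * u) *
    jacobiTheta₂ (u / Real.pi + τ / 2) τ

/-- `θ₁(u|τ) = -i ∑ (-1)^n q^{(n+1/2)²} e^{i(2n+1)u}`. -/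
def theta1 (u τ : ℂ) : ℂ :=
  -Complex.I * Complex.exp (Complex.I * Real.pi * τ / 4 + Complex.I * u) *
    jacobiTheta₂ (u / Real.pi + τ / 2 + 1 / 2) τ

/-- The parameters of the open chain with `N` sites: elliptic parameter `ω`, coupling `η`,
boundary parameters `ζ = ζ₋`, `κ = κ₋`, `τ = τ₋`, and inhomogeneities `ξ`. -/
structure Chain (N : ℕ) where
  ω : ℂ
  η : ℂ
  ζ : ℂ
  κ : ℂ
  τ : ℂ
  ξ : Fin N → ℂ

/-- Basis labels of `R_N = ⊗ₙ ℂ²`. -/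
abbrev Site (N : ℕ) : Type := Fin N → Fin 2

/-- `End(R_N)`. -/
abbrev ChainOp (N : ℕ) : Type := Matrix (Site N) (Site N) ℂ

/-- `End(R_0 ⊗ R_N)`. -/
abbrev AuxOp (N : ℕ) : Type := Matrix (Fin 2 × Site N) (Fin 2 × Site N) ℂ

/-- The operator on `R_0 ⊗ R_N` acting as `X` on `R_0 ⊗ R_n` and trivially elsewhere. -/
def onSite {N : ℕ} (n : Fin N) (X : Matrix (Fin 2 × Fin 2) (Fin 2 × Fin 2) ℂ) : AuxOp N :=
  Matrix.of fun x y =>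
    if ∀ m, m ≠ n → x.2 m = y.2 m then X (x.1, x.2 n) (y.1, y.2 n) else 0

/-- Transposition in the auxiliary space `R_0`. -/
def auxTranspose {N : ℕ} (X : AuxOp N) : AuxOp N :=
  Matrix.of fun x y => X (y.1, x.2) (x.1, y.2)

/-- The Pauli matrix `σ^y`. -/
def sigmaY : Matrix (Fin 2) (Fin 2) ℂ := !![0, -Complex.I; Complex.I, 0]

namespace Chain

variable {N : ℕ} (P : Chain N)

/-- `θ₁(u|2ω)`. -/
def t1 (u : ℂ) : ℂ := theta1 u (2 * P.ω)

/-- `θ₄(u|2ω)`. -/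
def t4 (u : ℂ) : ℂ := theta4 u (2 * P.ω)

/-- `θ(u) = θ₁(u|ω)`. -/
def theta (u : ℂ) : ℂ := theta1 u P.ω

/-- The common prefactor `2 / (θ₂(0|ω) θ₄(0|2ω))` of the vertex weights. -/
def prefactor : ℂ := 2 / (theta2 0 P.ω * P.t4 0)

/-- The vertex weight `a(λ)` (roman). -/
def wa (l : ℂ) : ℂ := P.prefactor * (P.t4 P.η * P.t1 (l + P.η) * P.t4 l)

/-- The vertex weight `b(λ)` (roman). -/
def wb (l : ℂ) : ℂ := P.prefactor * (P.t4 P.η * P.t1 l * P.t4 (l + P.η))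

/-- The vertex weight `c(λ)` (roman). -/
def wc (l : ℂ) : ℂ := P.prefactor * (P.t1 P.η * P.t4 l * P.t4 (l + P.η))

/-- The vertex weight `d(λ)` (roman). -/
def wd (l : ℂ) : ℂ := P.prefactor * (P.t1 P.η * P.t1 (l + P.η) * P.t1 l)

/-- The 8-vertex R-matrix, in the ordered basis `(0,0), (0,1), (1,0), (1,1)`. -/
def R (l : ℂ) : Matrix (Fin 2 × Fin 2) (Fin 2 × Fin 2) ℂ :=
  Matrix.submatrix
    !![P.wa l, 0, 0, P.wd l;
       0, P.wb l, P.wc l, 0;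
       0, P.wc l, P.wb l, 0;
       P.wd l, 0, 0, P.wa l]
    finProdFinEquiv finProdFinEquiv

/-- The scalar boundary matrix `K(λ; ζ, κ, τ)`. -/
def K (l : ℂ) : Matrix (Fin 2) (Fin 2) ℂ :=
  !![P.t4 P.ζ * P.t4 (-l + P.ζ) * P.t1 (l + P.ζ) / P.t1 P.ζ,
     P.κ * Complex.exp P.τ * P.t1 (2 * l) *
        (P.t4 l ^ 2 - Complex.exp (-2 * P.τ) * P.t1 l ^ 2) * P.t4 P.ζ ^ 3 /
        (P.t1 P.ζ * P.t4 0 ^ 2 * P.t4 (2 * l));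
     P.κ * Complex.exp (-P.τ) * P.t1 (2 * l) *
        (P.t4 l ^ 2 - Complex.exp (2 * P.τ) * P.t1 l ^ 2) * P.t4 P.ζ ^ 3 /
        (P.t1 P.ζ * P.t4 0 ^ 2 * P.t4 (2 * l)),
     P.t4 P.ζ * P.t1 (-l + P.ζ) * P.t4 (l + P.ζ) / P.t1 P.ζ]

/-- `K₋(λ) = K(λ - η/2; ζ₋, κ₋, τ₋)`. -/
def Kminus (l : ℂ) : Matrix (Fin 2) (Fin 2) ℂ := P.K (l - P.η / 2)

/-- The bulk monodromy matrix `R_{0N}(λ-ξ_N-η/2) ⋯ R_{01}(λ-ξ_1-η/2)`. -/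
def M (l : ℂ) : AuxOp N :=
  ((List.finRange N).reverse.map fun n => onSite n (P.R (l - P.ξ n - P.η / 2))).prod

/-- `M̂(λ) = (-1)^N σ₀^y M(-λ)^{t₀} σ₀^y`. -/
def Mhat (l : ℂ) : AuxOp N :=
  (-1 : ℂ) ^ N • ((sigmaY ⊗ₖ (1 : ChainOp N)) * auxTranspose (P.M (-l)) *
    (sigmaY ⊗ₖ (1 : ChainOp N)))

/-- The boundary monodromy matrix `U₋(λ) = M₀(λ) K₋(λ) M̂₀(λ)`. -/
def U (l : ℂ) : AuxOp N := P.M l * (P.Kminus l ⊗ₖ (1 : ChainOp N)) * P.Mhat l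

/-- `𝒜₋(λ)`. -/
def A (l : ℂ) : ChainOp N := (P.U l).submatrix (Prod.mk 0) (Prod.mk 0)

/-- `ℬ₋(λ)`. -/
def B (l : ℂ) : ChainOp N := (P.U l).submatrix (Prod.mk 0) (Prod.mk 1)

/-- `𝒞₋(λ)`. -/
def C (l : ℂ) : ChainOp N := (P.U l).submatrix (Prod.mk 1) (Prod.mk 0)

/-- `𝒟₋(λ)`. -/
def D (l : ℂ) : ChainOp N := (P.U l).submatrix (Prod.mk 1) (Prod.mk 1)

/-- `p(λ) = 2 θ₄(2λ+η|2ω) θ₁(2λ-η|2ω) / θ₂(0|ω)`. -/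
def p (l : ℂ) : ℂ := 2 * P.t4 (2 * l + P.η) * P.t1 (2 * l - P.η) / theta2 0 P.ω

/-- The quotient `det_q U₋(λ) / p(λ-η/2)`. -/
def qdetOverP (l : ℂ) : ChainOp N :=
  P.A (l + P.η / 2) * P.A (P.η / 2 - l) + P.B (l + P.η / 2) * P.C (P.η / 2 - l)

/-- The quantum determinant `det_q U₋(λ)`, an operator on the chain. -/
def qdet (l : ℂ) : ChainOp N := P.p (l - P.η / 2) • P.qdetOverP l

/-- `√k = θ₂(0|2ω) / θ₃(0|2ω)`, the square root of the elliptic modulus. -/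
def sqrtk : ℂ := theta2 0 (2 * P.ω) / theta3 0 (2 * P.ω)

/-- The elliptic modulus `k`. -/
def k : ℂ := P.sqrtk ^ 2

/-- Jacobi's `sn` of modulus `k` at `2 K_k u`, where `2 K_k = θ₃(0|2ω)²`. -/
def sn (u : ℂ) : ℂ := 1 / P.sqrtk * (P.t1 u / P.t4 u)

/-- `h(λ; ζ) = θ₄(λ+ζ|2ω) θ₄(λ-ζ|2ω)`. -/
def h (l : ℂ) : ℂ := P.t4 (l + P.ζ) * P.t4 (l - P.ζ)

/-- `g₋(λ)`, with `sqrt` the chosen branch of the complex square root. -/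
def g (sqrt : ℂ → ℂ) (l : ℂ) : ℂ :=
  P.h (l - P.η / 2) / P.sn P.ζ *
    (sqrt (P.sn (l + P.ζ - P.η / 2) * P.sn (-l + P.ζ + P.η / 2)) +
      P.κ * P.sn (2 * l - P.η) *
        sqrt ((1 - P.k * Complex.exp (2 * P.τ) * P.sn (l - P.η / 2) ^ 2) *
          (1 - P.k * Complex.exp (-2 * P.τ) * P.sn (l - P.η / 2) ^ 2)) /
        (1 - P.k ^ 2 * P.sn P.ζ ^ 2 * P.sn (l - P.η / 2) ^ 2))

/-- The scalar function `a(λ) = ∏ₙ θ(λ - ξₙ + η/2)` (italic). -/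
def bulkA (l : ℂ) : ℂ := ∏ n, P.theta (l - P.ξ n + P.η / 2)

/-- The scalar function `d(λ) = a(λ - η)` (italic). -/
def bulkD (l : ℂ) : ℂ := P.bulkA (l - P.η)

/-- `Â₋(λ) = g₋(λ) a(λ) d(-λ)`. -/
def Ahat (sqrt : ℂ → ℂ) (l : ℂ) : ℂ := P.g sqrt l * P.bulkA l * P.bulkD (-l)

/-- `λ` is not one of the poles of `K₋`, i.e. `θ₄(2λ-η|2ω) ≠ 0`. -/
def Regular (l : ℂ) : Prop := P.t4 (2 * l - P.η) ≠ 0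

end Chain

end EightVertex

end

/-! Everything rests on two algebraic facts about the dressed matrix U(λ), read as a 2×2 matrix
whose entries are operators on the chain (`blocks`). Crossing symmetry R(λ) → R(-λ-η) turns `Mhat`
into the product of R-matrices in the opposite order with arguments λ+ξₙ-η/2, the sign (-1)^N
cancelling one sign per site. So U is K₋ dressed by successive sites, X ↦ R(λ-ξₙ-η/2) X R(λ+ξₙ-η/2)
(`blocks_U`), and both facts follow by induction on the sites.

Parity: a linear map of 2×2 block matrices, with coefficients the weights at 2λ, sends U(λ) to
p(λ)U(-λ). For K₋ alone this is a set of theta identities, which is claim 2. The map intertwines the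
dressing at λ with the dressing at -λ (`parityMap_conj`), because of six relations of Yang-Baxter
type between the weights at u, v and u+v+η, here with u+v+η = 2λ. Its four entries are claim 1.

Inversion: in U(λ+η/2)U(η/2-λ) the inner R-matrices meet at opposite arguments and collapse to
scalars by unitarity, while K(λ)K(-λ) = det K(λ) since K(-λ) is the adjugate of K(λ). The product is
therefore an explicit even scalar (`dressed_mul_dressed`, `qdetScalar`). Diagonal entries give claim
3, the scalar form gives invertibility and centrality, and claim 6 amounts to factoring det K(λ) as
g₋(λ+η/2)g₋(-λ+η/2), a difference of squares (`g_mul_g`).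

All theta identities come from one product formula (`jacobiTheta₂_mul`). It yields Weierstrass'
three-term relation, its half-period shifts, and the passage between the moduli ω and 2ω. -/

noncomputable section

namespace EightVertex

/-! ### Theta functions -/

/-- Pairs of integers, split according to the parity of their sum. -/
def intProdParityEquiv : (ℤ × ℤ) ⊕ (ℤ × ℤ) ≃ ℤ × ℤ where
  toFun := Sum.elim (fun p => (p.1 + p.2, p.1 - p.2)) (fun p => (p.1 + p.2 + 1, p.1 - p.2))
  invFun p := if (p.1 + p.2) % 2 = 0 then Sum.inl ((p.1 + p.2) / 2, (p.1 - p.2) / 2)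
    else Sum.inr ((p.1 + p.2 - 1) / 2, (p.1 - p.2 - 1) / 2)
  left_inv := by
    rintro (⟨p, q⟩ | ⟨p, q⟩)
    · have : (p + q + (p - q)) % 2 = 0 := by omega
      simp only [Sum.elim_inl, this, if_true, Sum.inl.injEq, Prod.mk.injEq]
      omega
    · have : ¬ (p + q + 1 + (p - q)) % 2 = 0 := by omega
      simp only [Sum.elim_inr, this, if_false, Sum.inr.injEq, Prod.mk.injEq]
      omega
  right_inv := by
    rintro ⟨n, m⟩
    by_cases h : (n + m) % 2 = 0
    · simp only [h, if_true, Sum.elim_inl, Prod.mk.injEq]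
      omega
    · simp only [h, if_false, Sum.elim_inr, Prod.mk.injEq]
      omega

theorem hasSum_jacobiTheta₂_mul (z w : ℂ) {τ : ℂ} (hτ : 0 < τ.im) :
    HasSum (fun p : ℤ × ℤ => jacobiTheta₂_term p.1 z τ * jacobiTheta₂_term p.2 w τ)
      (jacobiTheta₂ z τ * jacobiTheta₂ w τ) :=
  HasSum.mul (f := fun n => jacobiTheta₂_term n z τ) (g := fun n => jacobiTheta₂_term n w τ)
    (hasSum_jacobiTheta₂_term z hτ) (hasSum_jacobiTheta₂_term w hτ)
    (summable_mul_of_summable_norm (f := fun n => jacobiTheta₂_term n z τ)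
      (g := fun n => jacobiTheta₂_term n w τ)
      ((summable_jacobiTheta₂_term_iff z τ).mpr hτ).norm
      ((summable_jacobiTheta₂_term_iff w τ).mpr hτ).norm)

/-- (p+q)² + (p-q)² = 2p² + 2q²: the quadratic form stays diagonal and only τ doubles. The odd case
acquires terms linear in p and q, which shift the arguments by τ. -/
theorem jacobiTheta₂_term_mul_even (x y τ : ℂ) (p q : ℤ) :
    jacobiTheta₂_term (p + q) x τ * jacobiTheta₂_term (p - q) y τ =
      jacobiTheta₂_term p (x + y) (2 * τ) * jacobiTheta₂_term q (x - y) (2 * τ) := by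
  simp only [jacobiTheta₂_term, ← Complex.exp_add]
  congr 1
  push_cast
  ring

theorem jacobiTheta₂_term_mul_odd (x y τ : ℂ) (p q : ℤ) :
    jacobiTheta₂_term (p + q + 1) x τ * jacobiTheta₂_term (p - q) y τ =
      Complex.exp (2 * Real.pi * Complex.I * x + Real.pi * Complex.I * τ) *
        (jacobiTheta₂_term p (x + y + τ) (2 * τ) *
          jacobiTheta₂_term q (x - y + τ) (2 * τ)) := by
  simp only [jacobiTheta₂_term, ← Complex.exp_add]
  congr 1
  push_cast
  ring

/-- The product of two theta functions of the same modulus, through theta functions of twice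
that modulus. -/
theorem jacobiTheta₂_mul (x y : ℂ) {τ : ℂ} (hτ : 0 < τ.im) :
    jacobiTheta₂ x τ * jacobiTheta₂ y τ =
      jacobiTheta₂ (x + y) (2 * τ) * jacobiTheta₂ (x - y) (2 * τ) +
        Complex.exp (2 * Real.pi * Complex.I * x + Real.pi * Complex.I * τ) *
          (jacobiTheta₂ (x + y + τ) (2 * τ) * jacobiTheta₂ (x - y + τ) (2 * τ)) := by
  have h2 : 0 < (2 * τ).im := by simpa using hτ
  have h := intProdParityEquiv.hasSum_iff.mpr (hasSum_jacobiTheta₂_mul x y hτ)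
  refine h.unique (HasSum.sum ?_ ?_)
  · exact (hasSum_jacobiTheta₂_mul (x + y) (x - y) h2).congr_fun fun p =>
      jacobiTheta₂_term_mul_even x y τ p.1 p.2
  · exact ((hasSum_jacobiTheta₂_mul (x + y + τ) (x - y + τ) h2).mul_left _).congr_fun fun p =>
      jacobiTheta₂_term_mul_odd x y τ p.1 p.2

theorem exp_shift {a b : ℂ} {m : ℤ} (h : a = b + m * (2 * Real.pi * Complex.I)) :
    Complex.exp a = Complex.exp b :=
  Complex.exp_eq_exp_iff_exists_int.mpr ⟨m, h⟩

theorem exp_shift_half {a b : ℂ} (h : a = b + Real.pi * Complex.I) :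
    Complex.exp a = -Complex.exp b := by
  rw [h, Complex.exp_add, Complex.exp_pi_mul_I]; ring

/-! ### Parity and half-period shifts of the theta functions. -/

section

variable (τ : ℂ)

theorem theta4_neg (u : ℂ) : theta4 (-u) τ = theta4 u τ := by
  unfold theta4
  rw [← jacobiTheta₂_neg_left, ← jacobiTheta₂_add_left]
  congr 1
  ring

theorem theta1_neg (u : ℂ) : theta1 (-u) τ = -theta1 u τ := by
  unfold theta1
  have e : jacobiTheta₂ (-u / Real.pi + τ / 2 + 1 / 2) τ =
      jacobiTheta₂ ((u / Real.pi - τ / 2 + 1 / 2)) τ := by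
    rw [← jacobiTheta₂_neg_left, ← jacobiTheta₂_add_left]
    congr 1
    ring
  have e' : jacobiTheta₂ (u / Real.pi + τ / 2 + 1 / 2) τ =
      jacobiTheta₂ ((u / Real.pi - τ / 2 + 1 / 2) + τ) τ := by
    congr 1
    ring
  rw [e, e', jacobiTheta₂_add_left']
  have hpi : (Real.pi : ℂ) ≠ 0 := by exact_mod_cast Real.pi_ne_zero
  have : Complex.exp (Complex.I * Real.pi * τ / 4 + Complex.I * u) *
      Complex.exp (-Real.pi * Complex.I * (τ + 2 * (u / Real.pi - τ / 2 + 1 / 2))) =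
      -Complex.exp (Complex.I * Real.pi * τ / 4 + Complex.I * -u) := by
    rw [← Complex.exp_add, ← neg_eq_iff_eq_neg, eq_comm]
    apply exp_shift_half
    field_simp
    ring
  linear_combination (-Complex.I * jacobiTheta₂ (u / Real.pi - τ / 2 + 1 / 2) τ) * this

/-- The factor of the shift by the half period `πτ/2`. -/
def shiftFactor (u : ℂ) : ℂ :=
  Complex.I * Complex.exp (-(Complex.I * Real.pi * τ / 4 + Complex.I * u))

theorem shiftFactor_ne_zero (u : ℂ) : shiftFactor τ u ≠ 0 :=
  mul_ne_zero Complex.I_ne_zero (Complex.exp_ne_zero _)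

/-- The factor is the exponential of an affine function of u. Hence half-period shifts multiply
every term of a homogeneous three-term relation by the same nonzero constant, which cancels. -/
theorem shiftFactor_mul_congr {u v u' v' : ℂ} (h : u + v = u' + v') :
    shiftFactor τ u * shiftFactor τ v = shiftFactor τ u' * shiftFactor τ v' := by
  unfold shiftFactor
  rw [mul_mul_mul_comm, mul_mul_mul_comm Complex.I _ Complex.I, ← Complex.exp_add,
    ← Complex.exp_add]
  congr 2
  linear_combination (-Complex.I) * h

theorem theta4_add_half (u : ℂ) :
    theta4 (u + Real.pi * τ / 2) τ = shiftFactor τ u * theta1 u τ := by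
  unfold theta4 theta1 shiftFactor
  have hpi : (Real.pi : ℂ) ≠ 0 := by exact_mod_cast Real.pi_ne_zero
  have e : (u + Real.pi * τ / 2) / Real.pi + 1 / 2 = u / Real.pi + τ / 2 + 1 / 2 := by
    field_simp
  rw [e, Complex.exp_neg]
  have := inv_mul_cancel₀ (Complex.exp_ne_zero (Complex.I * Real.pi * τ / 4 + Complex.I * u))
  linear_combination jacobiTheta₂ (u / Real.pi + τ / 2 + 1 / 2) τ *
    ((Complex.exp (Complex.I * Real.pi * τ / 4 + Complex.I * u))⁻¹ *
      Complex.exp (Complex.I * Real.pi * τ / 4 + Complex.I * u) * Complex.I_sq - this)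

theorem theta1_add_half (u : ℂ) :
    theta1 (u + Real.pi * τ / 2) τ = shiftFactor τ u * theta4 u τ := by
  unfold theta4 theta1 shiftFactor
  have hpi : (Real.pi : ℂ) ≠ 0 := by exact_mod_cast Real.pi_ne_zero
  have e : (u + Real.pi * τ / 2) / Real.pi + τ / 2 + 1 / 2 = u / Real.pi + 1 / 2 + τ := by
    field_simp
    ring
  rw [e, jacobiTheta₂_add_left']
  have : Complex.exp (Complex.I * Real.pi * τ / 4 + Complex.I * (u + Real.pi * τ / 2)) *
      Complex.exp (-Real.pi * Complex.I * (τ + 2 * (u / Real.pi + 1 / 2))) =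
      -Complex.exp (-(Complex.I * Real.pi * τ / 4 + Complex.I * u)) := by
    rw [← Complex.exp_add, ← neg_eq_iff_eq_neg, eq_comm]
    apply exp_shift_half
    field_simp
    ring
  linear_combination (-Complex.I * jacobiTheta₂ (u / Real.pi + 1 / 2) τ) * this

/-! ### Three-term relations and addition formulas. -/

variable {τ} (hτ : 0 < τ.im)
include hτ

/-- The right side is the 2×2 determinant f(a)g(b) - g(a)f(b) with f(a) = θ₃(2a|2τ) and g(a) =
θ₂(2a|2τ). Weierstrass' relation is then the Plücker relation between four vectors of ℂ². -/
theorem theta1_mul_theta1 (a b : ℂ) :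
    theta1 (a + b) τ * theta1 (a - b) τ =
      jacobiTheta₂ (2 * a / Real.pi) (2 * τ) *
          (Complex.exp (Complex.I * Real.pi * τ / 2 + 2 * Complex.I * b) *
            jacobiTheta₂ (2 * b / Real.pi + τ) (2 * τ)) -
        (Complex.exp (Complex.I * Real.pi * τ / 2 + 2 * Complex.I * a) *
            jacobiTheta₂ (2 * a / Real.pi + τ) (2 * τ)) *
          jacobiTheta₂ (2 * b / Real.pi) (2 * τ) := by
  have hpi : (Real.pi : ℂ) ≠ 0 := by exact_mod_cast Real.pi_ne_zero
  have h := jacobiTheta₂_mul ((a + b) / Real.pi + τ / 2 + 1 / 2)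
    ((a - b) / Real.pi + τ / 2 + 1 / 2) hτ
  have e1 : (a + b) / Real.pi + τ / 2 + 1 / 2 + ((a - b) / Real.pi + τ / 2 + 1 / 2) =
      2 * a / Real.pi + τ + 1 := by ring
  have e2 : (a + b) / Real.pi + τ / 2 + 1 / 2 - ((a - b) / Real.pi + τ / 2 + 1 / 2) =
      2 * b / Real.pi := by ring
  have e3 : 2 * a / Real.pi + τ + 1 + τ = 2 * a / Real.pi + 2 * τ + 1 := by ring
  rw [e1, e2, e3, jacobiTheta₂_add_left, jacobiTheta₂_add_left, jacobiTheta₂_add_left'] at h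
  have f1 : Complex.exp (Complex.I * Real.pi * τ / 4 + Complex.I * (a + b)) *
      Complex.exp (Complex.I * Real.pi * τ / 4 + Complex.I * (a - b)) =
      Complex.exp (Complex.I * Real.pi * τ / 2 + 2 * Complex.I * a) := by
    rw [← Complex.exp_add]
    congr 1
    ring
  have f2 : Complex.exp (Complex.I * Real.pi * τ / 2 + 2 * Complex.I * a) *
      (Complex.exp (2 * Real.pi * Complex.I * ((a + b) / Real.pi + τ / 2 + 1 / 2) +
          Real.pi * Complex.I * τ) *
        Complex.exp (-Real.pi * Complex.I * (2 * τ + 2 * (2 * a / Real.pi)))) =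
      -Complex.exp (Complex.I * Real.pi * τ / 2 + 2 * Complex.I * b) := by
    rw [← Complex.exp_add, ← Complex.exp_add]
    apply exp_shift_half
    field_simp
    ring
  unfold theta1
  linear_combination
    (jacobiTheta₂ ((a + b) / Real.pi + τ / 2 + 1 / 2) τ *
      jacobiTheta₂ ((a - b) / Real.pi + τ / 2 + 1 / 2) τ *
      Complex.exp (Complex.I * Real.pi * τ / 4 + Complex.I * (a + b)) *
      Complex.exp (Complex.I * Real.pi * τ / 4 + Complex.I * (a - b))) * Complex.I_sq
    - (jacobiTheta₂ ((a + b) / Real.pi + τ / 2 + 1 / 2) τ *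
      jacobiTheta₂ ((a - b) / Real.pi + τ / 2 + 1 / 2) τ) * f1
    - Complex.exp (Complex.I * Real.pi * τ / 2 + 2 * Complex.I * a) * h
    - (jacobiTheta₂ (2 * a / Real.pi) (2 * τ) *
      jacobiTheta₂ (2 * b / Real.pi + τ) (2 * τ)) * f2

/-- Weierstrass' three-term relation. -/
theorem theta1_weierstrass (x y z w : ℂ) :
    theta1 (x + y) τ * theta1 (x - y) τ * (theta1 (z + w) τ * theta1 (z - w) τ) -
      theta1 (x + z) τ * theta1 (x - z) τ * (theta1 (y + w) τ * theta1 (y - w) τ) +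
      theta1 (x + w) τ * theta1 (x - w) τ * (theta1 (y + z) τ * theta1 (y - z) τ) = 0 := by
  simp only [theta1_mul_theta1 hτ]
  ring

theorem theta_weierstrass_4411 (x y z w : ℂ) :
    theta4 (x + y) τ * theta4 (x - y) τ * (theta1 (z + w) τ * theta1 (z - w) τ) -
      theta4 (x + z) τ * theta4 (x - z) τ * (theta1 (y + w) τ * theta1 (y - w) τ) +
      theta4 (x + w) τ * theta4 (x - w) τ * (theta1 (y + z) τ * theta1 (y - z) τ) = 0 := by
  have h := theta1_weierstrass hτ (x + Real.pi * τ / 2) y z w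
  simp only [add_right_comm x, add_sub_right_comm x, theta1_add_half] at h
  have e1 := shiftFactor_mul_congr τ (show x + z + (x - z) = x + y + (x - y) by ring)
  have e2 := shiftFactor_mul_congr τ (show x + w + (x - w) = x + y + (x - y) by ring)
  refine (mul_eq_zero_iff_left (mul_ne_zero (shiftFactor_ne_zero τ (x + y))
    (shiftFactor_ne_zero τ (x - y)))).mp ?_
  linear_combination h + theta4 (x + z) τ * theta4 (x - z) τ *
    (theta1 (y + w) τ * theta1 (y - w) τ) * e1 - theta4 (x + w) τ * theta4 (x - w) τ *
    (theta1 (y + z) τ * theta1 (y - z) τ) * e2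

theorem theta_weierstrass_1111_4444 (x y z w : ℂ) :
    theta1 (x + y) τ * theta1 (y - x) τ * (theta1 (z + w) τ * theta1 (z - w) τ) -
      theta4 (x + z) τ * theta4 (x - z) τ * (theta4 (y + w) τ * theta4 (y - w) τ) +
      theta4 (x + w) τ * theta4 (x - w) τ * (theta4 (y + z) τ * theta4 (y - z) τ) = 0 := by
  have h := theta_weierstrass_4411 hτ x (y + Real.pi * τ / 2) z w
  rw [← theta4_neg τ (x - (y + Real.pi * τ / 2)),
    show -(x - (y + Real.pi * τ / 2)) = y - x + Real.pi * τ / 2 by ring, ← add_assoc] at h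
  simp only [add_right_comm y, add_sub_right_comm y, theta1_add_half, theta4_add_half] at h
  have e1 := shiftFactor_mul_congr τ (show y + w + (y - w) = x + y + (y - x) by ring)
  have e2 := shiftFactor_mul_congr τ (show y + z + (y - z) = x + y + (y - x) by ring)
  refine (mul_eq_zero_iff_left (mul_ne_zero (shiftFactor_ne_zero τ (x + y))
    (shiftFactor_ne_zero τ (y - x)))).mp ?_
  linear_combination h + theta4 (x + z) τ * theta4 (x - z) τ *
    (theta4 (y + w) τ * theta4 (y - w) τ) * e1 - theta4 (x + w) τ * theta4 (x - w) τ *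
    (theta4 (y + z) τ * theta4 (y - z) τ) * e2

theorem theta_weierstrass_4114 (x y z w : ℂ) :
    theta4 (x + y) τ * theta1 (x - y) τ * (theta1 (z + w) τ * theta4 (z - w) τ) -
      theta4 (x + z) τ * theta1 (x - z) τ * (theta1 (y + w) τ * theta4 (y - w) τ) +
      theta1 (x + w) τ * theta4 (x - w) τ * (theta4 (y + z) τ * theta1 (y - z) τ) = 0 := by
  -- Quarter-period shifts, with the opposite sign for w: in each pair ± exactly one argument moves,
  -- by a full half period, which produces the mixed products θ₁θ₄.
  have h := theta1_weierstrass hτ (x + Real.pi * τ / 2 / 2) (y + Real.pi * τ / 2 / 2)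
    (z + Real.pi * τ / 2 / 2) (w - Real.pi * τ / 2 / 2)
  have s : ∀ a b : ℂ, a + Real.pi * τ / 2 / 2 + (b + Real.pi * τ / 2 / 2) =
      a + b + Real.pi * τ / 2 := fun a b => by ring
  have s1 : ∀ a b : ℂ, a + Real.pi * τ / 2 / 2 + (b - Real.pi * τ / 2 / 2) = a + b :=
    fun a b => by ring
  have s2 : ∀ a b : ℂ, a + Real.pi * τ / 2 / 2 - (b + Real.pi * τ / 2 / 2) = a - b :=
    fun a b => by ring
  have s3 : ∀ a b : ℂ, a + Real.pi * τ / 2 / 2 - (b - Real.pi * τ / 2 / 2) =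
      a - b + Real.pi * τ / 2 := fun a b => by ring
  simp only [s, s1, s2, s3, theta1_add_half] at h
  have e1 := shiftFactor_mul_congr τ (show x + z + (y - w) = x + y + (z - w) by ring)
  have e2 := shiftFactor_mul_congr τ (show x - w + (y + z) = x + y + (z - w) by ring)
  refine (mul_eq_zero_iff_left (mul_ne_zero (shiftFactor_ne_zero τ (x + y))
    (shiftFactor_ne_zero τ (z - w)))).mp ?_
  linear_combination h + theta4 (x + z) τ * theta1 (x - z) τ *
    (theta1 (y + w) τ * theta4 (y - w) τ) * e1 - theta1 (x + w) τ * theta4 (x - w) τ *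
    (theta4 (y + z) τ * theta1 (y - z) τ) * e2

theorem theta_addition_1414 (u v e : ℂ) :
    theta1 (u + e) τ * theta4 u τ * (theta1 (v + e) τ * theta4 v τ) -
      theta1 u τ * theta4 (u + e) τ * (theta1 v τ * theta4 (v + e) τ) =
      theta1 e τ * theta4 0 τ * (theta1 (u + v + e) τ * theta4 (u - v) τ) := by
  -- The first and last arguments coincide, so one factor of the third term becomes the constant
  -- θ₄(0).
  have h := theta_weierstrass_4114 hτ ((u + v + e) / 2) ((u - v - e) / 2) ((u - v + e) / 2)
    ((u + v + e) / 2)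
  rw [show (u + v + e) / 2 + (u - v - e) / 2 = u by ring,
    show (u + v + e) / 2 - (u - v - e) / 2 = v + e by ring,
    show (u - v + e) / 2 + (u + v + e) / 2 = u + e by ring,
    show (u - v + e) / 2 - (u + v + e) / 2 = -v by ring,
    show (u + v + e) / 2 + (u - v + e) / 2 = u + e by ring,
    show (u + v + e) / 2 - (u - v + e) / 2 = v by ring,
    show (u - v - e) / 2 + (u + v + e) / 2 = u by ring,
    show (u - v - e) / 2 - (u + v + e) / 2 = -(v + e) by ring,
    show (u + v + e) / 2 + (u + v + e) / 2 = u + v + e by ring,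
    show (u + v + e) / 2 - (u + v + e) / 2 = 0 by ring,
    show (u - v - e) / 2 + (u - v + e) / 2 = u - v by ring,
    show (u - v - e) / 2 - (u - v + e) / 2 = -e by ring,
    theta4_neg, theta4_neg, theta1_neg] at h
  linear_combination h

theorem theta_addition_4444 (u v e : ℂ) :
    theta4 (u + e) τ * theta4 u τ * (theta4 (v + e) τ * theta4 v τ) -
      theta1 u τ * theta1 (u + e) τ * (theta1 v τ * theta1 (v + e) τ) =
      theta4 e τ * theta4 0 τ * (theta4 (u + v + e) τ * theta4 (u - v) τ) := by
  have h := theta_weierstrass_1111_4444 hτ (-e / 2) (u + e / 2) (e / 2) (v + e / 2)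
  rw [show -e / 2 + (u + e / 2) = u by ring, show u + e / 2 - -e / 2 = u + e by ring,
    show e / 2 + (v + e / 2) = v + e by ring, show e / 2 - (v + e / 2) = -v by ring,
    show -e / 2 + e / 2 = 0 by ring, show -e / 2 - e / 2 = -e by ring,
    show u + e / 2 + (v + e / 2) = u + v + e by ring,
    show u + e / 2 - (v + e / 2) = u - v by ring,
    show -e / 2 + (v + e / 2) = v by ring, show -e / 2 - (v + e / 2) = -(v + e) by ring,
    show u + e / 2 + e / 2 = u + e by ring, show u + e / 2 - e / 2 = u by ring,
    theta4_neg, theta4_neg, theta1_neg] at h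
  linear_combination h

theorem theta_addition_4411 (u v e : ℂ) :
    theta1 u τ * theta1 (u + e) τ * (theta4 v τ * theta4 (v + e) τ) -
      theta4 u τ * theta4 (u + e) τ * (theta1 v τ * theta1 (v + e) τ) =
      theta4 e τ * theta4 0 τ * (theta1 (u + v + e) τ * theta1 (u - v) τ) := by
  have h := theta_weierstrass_4411 hτ (e / 2) (u + e / 2) (v + e / 2) (e / 2)
  rw [show e / 2 + (u + e / 2) = u + e by ring, show e / 2 - (u + e / 2) = -u by ring,
    show v + e / 2 + e / 2 = v + e by ring, show v + e / 2 - e / 2 = v by ring,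
    show e / 2 + (v + e / 2) = v + e by ring, show e / 2 - (v + e / 2) = -v by ring,
    show u + e / 2 + e / 2 = u + e by ring, show u + e / 2 - e / 2 = u by ring,
    show e / 2 + e / 2 = e by ring, show e / 2 - e / 2 = 0 by ring,
    show u + e / 2 + (v + e / 2) = u + v + e by ring,
    show u + e / 2 - (v + e / 2) = u - v by ring, theta4_neg, theta4_neg] at h
  linear_combination -h

/-! ### Doubling of the modulus and nonvanishing of the theta constants. -/

theorem theta1_mul_theta2_zero (u : ℂ) :
    theta1 u τ * theta2 0 τ = 2 * theta1 u (2 * τ) * theta4 u (2 * τ) := by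
  have hpi : (Real.pi : ℂ) ≠ 0 := by exact_mod_cast Real.pi_ne_zero
  have h := jacobiTheta₂_mul (u / Real.pi + τ / 2 + 1 / 2) (0 / Real.pi + τ / 2) hτ
  rw [show u / Real.pi + τ / 2 + 1 / 2 + (0 / Real.pi + τ / 2) =
      u / Real.pi + 2 * τ / 2 + 1 / 2 by ring,
    show u / Real.pi + τ / 2 + 1 / 2 - (0 / Real.pi + τ / 2) = u / Real.pi + 1 / 2 by ring,
    show u / Real.pi + 2 * τ / 2 + 1 / 2 + τ = u / Real.pi + 1 / 2 + 2 * τ by ring,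
    show u / Real.pi + 1 / 2 + τ = u / Real.pi + 2 * τ / 2 + 1 / 2 by ring,
    jacobiTheta₂_add_left'] at h
  have f1 : Complex.exp (2 * Real.pi * Complex.I * (u / Real.pi + τ / 2 + 1 / 2) +
      Real.pi * Complex.I * τ) *
      Complex.exp (-Real.pi * Complex.I * (2 * τ + 2 * (u / Real.pi + 1 / 2))) = 1 := by
    rw [← Complex.exp_add, ← Complex.exp_zero]
    congr 1
    field_simp
    ring
  have f2 : Complex.exp (Complex.I * Real.pi * τ / 4 + Complex.I * u) *
      Complex.exp (Complex.I * Real.pi * τ / 4 + Complex.I * 0) =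
      Complex.exp (Complex.I * Real.pi * (2 * τ) / 4 + Complex.I * u) := by
    rw [← Complex.exp_add]
    congr 1
    ring
  unfold theta1 theta2 theta4
  linear_combination (-Complex.I * jacobiTheta₂ (u / Real.pi + τ / 2 + 1 / 2) τ *
      jacobiTheta₂ (0 / Real.pi + τ / 2) τ) * f2 -
    Complex.I * Complex.exp (Complex.I * Real.pi * (2 * τ) / 4 + Complex.I * u) *
      (h + jacobiTheta₂ (u / Real.pi + 1 / 2) (2 * τ) *
        jacobiTheta₂ (u / Real.pi + 2 * τ / 2 + 1 / 2) (2 * τ) * f1)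

theorem theta2_zero_sq :
    theta2 0 τ ^ 2 = 2 * theta2 0 (2 * τ) * theta3 0 (2 * τ) := by
  have h := jacobiTheta₂_mul (0 / Real.pi + τ / 2) (0 / Real.pi + τ / 2) hτ
  rw [show 0 / Real.pi + τ / 2 + (0 / Real.pi + τ / 2) = 0 / Real.pi + 2 * τ / 2 by ring,
    show 0 / Real.pi + τ / 2 - (0 / Real.pi + τ / 2) = 0 / Real.pi by ring,
    show 0 / Real.pi + 2 * τ / 2 + τ = 0 / Real.pi + 2 * τ by ring,
    show 0 / Real.pi + τ = 0 / Real.pi + 2 * τ / 2 by ring, jacobiTheta₂_add_left'] at h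
  have f1 : Complex.exp (2 * Real.pi * Complex.I * (0 / Real.pi + τ / 2) +
      Real.pi * Complex.I * τ) *
      Complex.exp (-Real.pi * Complex.I * (2 * τ + 2 * (0 / Real.pi))) = 1 := by
    rw [← Complex.exp_add, ← Complex.exp_zero]
    congr 1
    ring
  have f2 : Complex.exp (Complex.I * Real.pi * τ / 4 + Complex.I * 0) ^ 2 =
      Complex.exp (Complex.I * Real.pi * (2 * τ) / 4 + Complex.I * 0) := by
    rw [sq, ← Complex.exp_add]
    congr 1
    ring
  unfold theta2 theta3
  linear_combination jacobiTheta₂ (0 / Real.pi + τ / 2) τ ^ 2 * f2 +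
    Complex.exp (Complex.I * Real.pi * (2 * τ) / 4 + Complex.I * 0) *
      (h + jacobiTheta₂ (0 / Real.pi) (2 * τ) *
        jacobiTheta₂ (0 / Real.pi + 2 * τ / 2) (2 * τ) * f1)

/-- If the constant vanished, the doubling formula would make θ₁θ₄ of modulus 2τ vanish identically.
By the identity theorem one factor would be zero, and up to exponentials both are translates of the
same theta function. The witness `hu` will come from θ₁(ζ|2ω) ≠ 0. -/
theorem theta2_zero_ne_zero {u : ℂ} (hu : jacobiTheta₂ u (2 * τ) ≠ 0) : theta2 0 τ ≠ 0 := by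
  intro h0
  have h2 : 0 < (2 * τ).im := by simpa using hτ
  have hpi : (Real.pi : ℂ) ≠ 0 := by exact_mod_cast Real.pi_ne_zero
  have hd : ∀ z, DifferentiableAt ℂ (jacobiTheta₂ · (2 * τ)) z := fun z =>
    differentiableAt_jacobiTheta₂_fst z h2
  have key : ∀ z, jacobiTheta₂ (z + τ) (2 * τ) * jacobiTheta₂ z (2 * τ) = 0 := fun z => by
    have := theta1_mul_theta2_zero hτ (Real.pi * (z - 1 / 2))
    rw [h0, mul_zero, theta1, theta4,
      show Real.pi * (z - 1 / 2) / Real.pi + 1 / 2 = z by field_simp; ring,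
      show Real.pi * (z - 1 / 2) / Real.pi + 2 * τ / 2 + 1 / 2 = z + τ by field_simp; ring] at this
    have he := Complex.exp_ne_zero (Complex.I * Real.pi * (2 * τ) / 4 +
      Complex.I * (Real.pi * (z - 1 / 2)))
    simpa [he, Complex.I_ne_zero] using this.symm
  have hA : ∀ f : ℂ → ℂ, Differentiable ℂ f → AnalyticOnNhd ℂ f Set.univ := fun f hf =>
    hf.differentiableOn.analyticOnNhd isOpen_univ
  rcases AnalyticOnNhd.eq_zero_or_eq_zero_of_mul_eq_zero
    (hA (fun z => jacobiTheta₂ (z + τ) (2 * τ))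
      (fun z => (hd (z + τ)).comp z (differentiableAt_id.add_const τ)))
    (hA (jacobiTheta₂ · (2 * τ)) hd) (fun z _ => key z) isPreconnected_univ with h | h
  · apply hu
    have := h (u - τ) trivial
    simpa using this
  · exact hu (h u trivial)

end

/-- n² and n have the same parity, so the extra sign of each term can be absorbed into the argument.
-/
theorem jacobiTheta₂_add_one (z τ : ℂ) :
    jacobiTheta₂ z (τ + 1) = jacobiTheta₂ (z + 1 / 2) τ := by
  refine tsum_congr fun n => ?_
  obtain ⟨m, hm⟩ : ∃ m : ℤ, n ^ 2 = n + 2 * m := by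
    obtain ⟨k, hk⟩ := Int.even_mul_pred_self n
    exact ⟨k, by linarith⟩
  have hm' : (n : ℂ) ^ 2 = n + 2 * m := by exact_mod_cast hm
  refine exp_shift (m := m) ?_
  linear_combination (Real.pi * Complex.I) * hm'

theorem theta4_zero_ne_zero {τ : ℂ} (hτ : 0 < τ.im) {u : ℂ} (hu : jacobiTheta₂ u (2 * τ) ≠ 0) :
    theta4 0 (2 * τ) ≠ 0 := by
  -- With σ = τ + 1/2 one has 2σ = 2τ + 1, hence θ₃(0|2σ) = θ₄(0|2τ), a factor of θ₂(0|σ)², which is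
  -- nonzero.
  have hσ : 0 < (τ + 1 / 2).im := by simpa using hτ
  have e : 2 * (τ + 1 / 2) = 2 * τ + 1 := by ring
  have h : jacobiTheta₂ (u - 1 / 2) (2 * (τ + 1 / 2)) ≠ 0 := by
    rwa [e, jacobiTheta₂_add_one, sub_add_cancel]
  have h' := theta2_zero_sq hσ
  intro h0
  refine theta2_zero_ne_zero hσ h (pow_eq_zero_iff two_ne_zero |>.mp ?_)
  rw [h', e, theta3, jacobiTheta₂_add_one]
  rw [theta4] at h0
  rw [h0, mul_zero]

/-! ### The vertex weights and the boundary matrix -/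

namespace Chain

variable {N : ℕ} (P : Chain N)

theorem t1_neg (u : ℂ) : P.t1 (-u) = -P.t1 u := theta1_neg _ u

theorem t4_neg (u : ℂ) : P.t4 (-u) = P.t4 u := theta4_neg _ u

theorem theta_neg (u : ℂ) : P.theta (-u) = -P.theta u := theta1_neg _ u

theorem wa_crossing (u : ℂ) : P.wa (-u - P.η) = -P.wb u := by
  rw [wa, wb, show -u - P.η + P.η = -u by ring, show -u - P.η = -(u + P.η) by ring, t1_neg,
    t4_neg]
  ring

theorem wb_crossing (u : ℂ) : P.wb (-u - P.η) = -P.wa u := by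
  rw [wa, wb, show -u - P.η + P.η = -u by ring, show -u - P.η = -(u + P.η) by ring, t1_neg,
    t4_neg]
  ring

theorem wc_crossing (u : ℂ) : P.wc (-u - P.η) = P.wc u := by
  rw [wc, wc, show -u - P.η + P.η = -u by ring, show -u - P.η = -(u + P.η) by ring, t4_neg,
    t4_neg]
  ring

theorem wd_crossing (u : ℂ) : P.wd (-u - P.η) = P.wd u := by
  rw [wd, wd, show -u - P.η + P.η = -u by ring, show -u - P.η = -(u + P.η) by ring, t1_neg,
    t1_neg]
  ring

section

variable (hω : 0 < P.ω.im)
include hω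

theorem im_two_mul_pos : 0 < (2 * P.ω).im := by simpa using hω

theorem t_addition_1414 (u v e : ℂ) :
    P.t1 (u + e) * P.t4 u * (P.t1 (v + e) * P.t4 v) -
      P.t1 u * P.t4 (u + e) * (P.t1 v * P.t4 (v + e)) =
      P.t1 e * P.t4 0 * (P.t1 (u + v + e) * P.t4 (u - v)) :=
  theta_addition_1414 (P.im_two_mul_pos hω) u v e

theorem t_addition_4444 (u v e : ℂ) :
    P.t4 (u + e) * P.t4 u * (P.t4 (v + e) * P.t4 v) -
      P.t1 u * P.t1 (u + e) * (P.t1 v * P.t1 (v + e)) =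
      P.t4 e * P.t4 0 * (P.t4 (u + v + e) * P.t4 (u - v)) :=
  theta_addition_4444 (P.im_two_mul_pos hω) u v e

theorem t_addition_4411 (u v e : ℂ) :
    P.t1 u * P.t1 (u + e) * (P.t4 v * P.t4 (v + e)) -
      P.t4 u * P.t4 (u + e) * (P.t1 v * P.t1 (v + e)) =
      P.t4 e * P.t4 0 * (P.t1 (u + v + e) * P.t1 (u - v)) :=
  theta_addition_4411 (P.im_two_mul_pos hω) u v e

theorem t4_add_mul_t4_sub (u v : ℂ) :
    P.t4 0 ^ 2 * (P.t4 (u + v) * P.t4 (u - v)) =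
      P.t4 u ^ 2 * P.t4 v ^ 2 - P.t1 u ^ 2 * P.t1 v ^ 2 := by
  have := P.t_addition_4444 hω u v 0
  simp only [add_zero] at this
  linear_combination -this

theorem t1_add_mul_t1_sub (u v : ℂ) :
    P.t4 0 ^ 2 * (P.t1 (u + v) * P.t1 (u - v)) =
      P.t1 u ^ 2 * P.t4 v ^ 2 - P.t4 u ^ 2 * P.t1 v ^ 2 := by
  have := P.t_addition_4411 hω u v 0
  simp only [add_zero] at this
  linear_combination -this

theorem wa_wa_sub_wb_wb (u v : ℂ) :
    P.wa u * P.wa v - P.wb u * P.wb v =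
      P.prefactor ^ 2 * P.t4 P.η ^ 2 * P.t1 P.η * P.t4 0 *
        (P.t1 (u + v + P.η) * P.t4 (u - v)) := by
  unfold wa wb
  linear_combination (P.prefactor ^ 2 * P.t4 P.η ^ 2) * P.t_addition_1414 hω u v P.η

/-- The image of the preceding identity under the crossing v → -v-η. -/
theorem wb_wa_sub_wa_wb (u v : ℂ) :
    P.wb u * P.wa v - P.wa u * P.wb v =
      P.prefactor ^ 2 * P.t4 P.η ^ 2 * P.t1 P.η * P.t4 0 *
        (P.t1 (u - v) * P.t4 (u + v + P.η)) := by
  have h := P.wa_wa_sub_wb_wb hω u (-v - P.η)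
  rw [wa_crossing, wb_crossing, show u + (-v - P.η) + P.η = u - v by ring,
    show u - (-v - P.η) = u + v + P.η by ring] at h
  linear_combination h

theorem wc_wc_sub_wd_wd (u v : ℂ) :
    P.wc u * P.wc v - P.wd u * P.wd v =
      P.prefactor ^ 2 * P.t1 P.η ^ 2 * P.t4 P.η * P.t4 0 *
        (P.t4 (u + v + P.η) * P.t4 (u - v)) := by
  unfold wc wd
  linear_combination (P.prefactor ^ 2 * P.t1 P.η ^ 2) * P.t_addition_4444 hω u v P.η

theorem wd_wc_sub_wc_wd (u v : ℂ) :
    P.wd u * P.wc v - P.wc u * P.wd v =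
      P.prefactor ^ 2 * P.t1 P.η ^ 2 * P.t4 P.η * P.t4 0 *
        (P.t1 (u + v + P.η) * P.t1 (u - v)) := by
  unfold wc wd
  linear_combination (P.prefactor ^ 2 * P.t1 P.η ^ 2) * P.t_addition_4411 hω u v P.η

/-! The Yang-Baxter relations between the weights at `u`, `v` and `u + v + η`. -/

/-- Both brackets factor by the addition formulas; the common factor is θ₄(u-v), and the remaining
ratio is that of the weights at u+v+η. The next three relations follow the same scheme. -/
theorem yangBaxter_bc (u v : ℂ) :
    P.wb (u + v + P.η) * (P.wc u * P.wc v - P.wd u * P.wd v) =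
      P.wc (u + v + P.η) * (P.wa u * P.wa v - P.wb u * P.wb v) := by
  rw [wc_wc_sub_wd_wd P hω, wa_wa_sub_wb_wb P hω, wb, wc]
  ring

theorem yangBaxter_ad (u v : ℂ) :
    P.wa (u + v + P.η) * (P.wd u * P.wc v - P.wc u * P.wd v) =
      P.wd (u + v + P.η) * (P.wb u * P.wa v - P.wa u * P.wb v) := by
  rw [wd_wc_sub_wc_wd P hω, wb_wa_sub_wa_wb P hω, wa, wd]
  ring

theorem yangBaxter_ca (u v : ℂ) :
    P.wc u * (P.wb (u + v + P.η) * P.wa v - P.wa (u + v + P.η) * P.wb v) =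
      P.wa u * (P.wc (u + v + P.η) * P.wc v - P.wd (u + v + P.η) * P.wd v) := by
  rw [wc_wc_sub_wd_wd P hω, wb_wa_sub_wa_wb P hω, wa, wc,
    show u + v + P.η - v = u + P.η by ring]
  ring

theorem yangBaxter_db (u v : ℂ) :
    P.wd u * (P.wa (u + v + P.η) * P.wa v - P.wb (u + v + P.η) * P.wb v) =
      P.wb u * (P.wd (u + v + P.η) * P.wc v - P.wc (u + v + P.η) * P.wd v) := by
  rw [wd_wc_sub_wc_wd P hω, wa_wa_sub_wb_wb P hω, wb, wd,
    show u + v + P.η - v = u + P.η by ring]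
  ring

theorem theta_mul_theta2_zero (u : ℂ) :
    P.theta u * theta2 0 P.ω = 2 * P.t1 u * P.t4 u := theta1_mul_theta2_zero hω u

variable (hζ : P.t1 P.ζ ≠ 0)
include hζ

omit hω in
theorem exists_jacobiTheta₂_ne_zero : ∃ u, jacobiTheta₂ u (2 * P.ω) ≠ 0 := by
  refine ⟨_, right_ne_zero_of_mul (a := -Complex.I * Complex.exp (Complex.I * Real.pi *
    (2 * P.ω) / 4 + Complex.I * P.ζ)) hζ⟩

theorem theta2_ne_zero : theta2 0 P.ω ≠ 0 :=
  let ⟨_, hu⟩ := P.exists_jacobiTheta₂_ne_zero hζ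
  theta2_zero_ne_zero hω hu

theorem t4_zero_ne_zero : P.t4 0 ≠ 0 :=
  let ⟨_, hu⟩ := P.exists_jacobiTheta₂_ne_zero hζ
  theta4_zero_ne_zero hω hu

theorem sqrtk_ne_zero : P.sqrtk ≠ 0 := by
  have h := theta2_zero_sq hω
  have h' : theta2 0 P.ω ^ 2 ≠ 0 := pow_ne_zero 2 (P.theta2_ne_zero hω hζ)
  rw [h] at h'
  exact div_ne_zero (right_ne_zero_of_mul (left_ne_zero_of_mul h')) (right_ne_zero_of_mul h')

theorem prefactor_mul : P.prefactor * (theta2 0 P.ω * P.t4 0) = 2 := by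
  have := P.theta2_ne_zero hω hζ
  have := P.t4_zero_ne_zero hω hζ
  unfold prefactor
  field_simp

/-! Unitarity. -/

/-- The addition formula collapses the left side to a multiple of θ₁θ₄(η+u)·θ₁θ₄(η-u) of modulus 2ω;
the doubling formula turns each θ₁θ₄ into θ of modulus ω. -/
theorem wa_wa_add_wd_wd (u : ℂ) :
    P.wa u * P.wa (-u) + P.wd u * P.wd (-u) = P.theta (P.η + u) * P.theta (P.η - u) := by
  have h2 := P.theta2_ne_zero hω hζ
  have e1 := P.theta_mul_theta2_zero hω (P.η + u)
  have e2 := P.theta_mul_theta2_zero hω (P.η - u)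
  have e3 := P.prefactor_mul hω hζ
  have e4 := P.t4_add_mul_t4_sub hω P.η u
  rw [wa, wa, wd, wd, show -u + P.η = P.η - u by ring, show u + P.η = P.η + u by ring, t4_neg,
    t1_neg]
  apply mul_right_cancel₀ (pow_ne_zero 2 h2)
  linear_combination (-P.theta (P.η + u) * theta2 0 P.ω) * e2 -
    (2 * P.t1 (P.η - u) * P.t4 (P.η - u)) * e1 +
    (P.t1 (P.η + u) * P.t4 (P.η + u) * P.t1 (P.η - u) * P.t4 (P.η - u) *
      (P.prefactor * (theta2 0 P.ω * P.t4 0) + 2)) * e3 -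
    (P.prefactor ^ 2 * theta2 0 P.ω ^ 2 * P.t1 (P.η + u) * P.t1 (P.η - u)) * e4

theorem wb_wb_add_wc_wc (u : ℂ) :
    P.wb u * P.wb (-u) + P.wc u * P.wc (-u) = P.theta (P.η + u) * P.theta (P.η - u) := by
  have h2 := P.theta2_ne_zero hω hζ
  have e1 := P.theta_mul_theta2_zero hω (P.η + u)
  have e2 := P.theta_mul_theta2_zero hω (P.η - u)
  have e3 := P.prefactor_mul hω hζ
  have e4 := P.t1_add_mul_t1_sub hω P.η u
  rw [wb, wb, wc, wc, show -u + P.η = P.η - u by ring, show u + P.η = P.η + u by ring, t4_neg,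
    t1_neg]
  apply mul_right_cancel₀ (pow_ne_zero 2 h2)
  linear_combination (-P.theta (P.η + u) * theta2 0 P.ω) * e2 -
    (2 * P.t1 (P.η - u) * P.t4 (P.η - u)) * e1 +
    (P.t1 (P.η + u) * P.t4 (P.η + u) * P.t1 (P.η - u) * P.t4 (P.η - u) *
      (P.prefactor * (theta2 0 P.ω * P.t4 0) + 2)) * e3 -
    (P.prefactor ^ 2 * theta2 0 P.ω ^ 2 * P.t4 (P.η + u) * P.t4 (P.η - u)) * e4

omit hω hζ in
theorem wa_wd_add_wd_wa (u : ℂ) : P.wa u * P.wd (-u) + P.wd u * P.wa (-u) = 0 := by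
  rw [wa, wa, wd, wd, t4_neg, t1_neg]
  ring

omit hω hζ in
theorem wb_wc_add_wc_wb (u : ℂ) : P.wb u * P.wc (-u) + P.wc u * P.wb (-u) = 0 := by
  rw [wb, wb, wc, wc, t4_neg, t1_neg]
  ring

/-! The parity relations of the boundary matrix. -/

omit hζ in
-- Used with x = λ-η/2 and y = λ+η/2, so that y-x = η and x+y = 2λ, the arguments of the weights,
-- and with z = ±ζ for the two diagonal entries.
theorem t_boundary_diag (x y z : ℂ) :
    P.t4 0 * P.t1 (2 * x) * (P.t1 (z - y) * P.t4 (z + y)) +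
      P.t1 (y - x) * P.t4 (x + y) * (P.t4 (z - x) * P.t1 (z + x)) =
      P.t4 (y - x) * P.t1 (x + y) * (P.t1 (z - x) * P.t4 (z + x)) := by
  have h := P.t_addition_1414 hω (z - x) (-(x + y)) (2 * x)
  rw [show z - x + 2 * x = z + x by ring, show -(x + y) + 2 * x = -(y - x) by ring,
    show z - x + -(x + y) + 2 * x = z - y by ring, show z - x - -(x + y) = z + y by ring,
    t1_neg, t1_neg, t4_neg, t4_neg] at h
  linear_combination -h

/-- Here (s, r) stands for (e^τ, e^{-τ}) or its swap. The relation is linear in (s, r), so one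
identity serves both off-diagonal entries. -/
theorem t_boundary_offdiag (x y s r : ℂ) :
    P.t4 0 * P.t4 (2 * x) * (s * P.t4 y ^ 2 - r * P.t1 y ^ 2) =
      P.t4 (y - x) * P.t4 (x + y) * (s * P.t4 x ^ 2 - r * P.t1 x ^ 2) -
        P.t1 (y - x) * P.t1 (x + y) * (r * P.t4 x ^ 2 - s * P.t1 x ^ 2) := by
  have h0 := P.t4_zero_ne_zero hω hζ
  have h1 := P.t4_add_mul_t4_sub hω y x
  have h2 := P.t1_add_mul_t1_sub hω y x
  have h3 := P.t4_add_mul_t4_sub hω x x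
  rw [add_comm y x] at h1 h2
  rw [sub_self, ← two_mul] at h3
  apply mul_left_cancel₀ (pow_ne_zero 2 h0)
  linear_combination (s * P.t4 y ^ 2 - r * P.t1 y ^ 2) * h3 -
    (s * P.t4 x ^ 2 - r * P.t1 x ^ 2) * h1 + (r * P.t4 x ^ 2 - s * P.t1 x ^ 2) * h2

theorem p_mul_Kminus_00 (l : ℂ) :
    P.p l * P.Kminus (-l) 0 0 =
      P.wb (2 * l) * P.Kminus l 1 1 - P.wc (2 * l) * P.Kminus l 0 0 := by
  have h2 := P.theta2_ne_zero hω hζ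
  have h4 := P.t4_zero_ne_zero hω hζ
  have h := P.t_boundary_diag hω (l - P.η / 2) (l + P.η / 2) P.ζ
  rw [show 2 * (l - P.η / 2) = 2 * l - P.η by ring, show l + P.η / 2 - (l - P.η / 2) = P.η by ring,
    show l - P.η / 2 + (l + P.η / 2) = 2 * l by ring] at h
  simp only [Kminus, K, Matrix.of_apply, Matrix.cons_val', Matrix.cons_val_zero,
    Matrix.cons_val_one, Matrix.cons_val_fin_one]
  rw [show -(-l - P.η / 2) + P.ζ = P.ζ + (l + P.η / 2) by ring,
    show -l - P.η / 2 + P.ζ = P.ζ - (l + P.η / 2) by ring,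
    show -(l - P.η / 2) + P.ζ = P.ζ - (l - P.η / 2) by ring,
    show l - P.η / 2 + P.ζ = P.ζ + (l - P.η / 2) by ring, p, wb, wc, prefactor]
  generalize l - P.η / 2 = x at h ⊢
  generalize l + P.η / 2 = y at h ⊢
  field_simp
  linear_combination P.t4 P.ζ * P.t4 (2 * l + P.η) * h

theorem p_mul_Kminus_11 (l : ℂ) :
    P.p l * P.Kminus (-l) 1 1 =
      P.wb (2 * l) * P.Kminus l 0 0 - P.wc (2 * l) * P.Kminus l 1 1 := by
  have h2 := P.theta2_ne_zero hω hζ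
  have h4 := P.t4_zero_ne_zero hω hζ
  have h := P.t_boundary_diag hω (l - P.η / 2) (l + P.η / 2) (-P.ζ)
  rw [show 2 * (l - P.η / 2) = 2 * l - P.η by ring, show l + P.η / 2 - (l - P.η / 2) = P.η by ring,
    show l - P.η / 2 + (l + P.η / 2) = 2 * l by ring,
    show -P.ζ - (l + P.η / 2) = -(P.ζ + (l + P.η / 2)) by ring,
    show -P.ζ + (l + P.η / 2) = -(P.ζ - (l + P.η / 2)) by ring,
    show -P.ζ - (l - P.η / 2) = -(P.ζ + (l - P.η / 2)) by ring,
    show -P.ζ + (l - P.η / 2) = -(P.ζ - (l - P.η / 2)) by ring, t1_neg, t1_neg, t1_neg, t4_neg,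
    t4_neg, t4_neg] at h
  simp only [Kminus, K, Matrix.of_apply, Matrix.cons_val', Matrix.cons_val_zero,
    Matrix.cons_val_one, Matrix.cons_val_fin_one]
  rw [show -(-l - P.η / 2) + P.ζ = P.ζ + (l + P.η / 2) by ring,
    show -l - P.η / 2 + P.ζ = P.ζ - (l + P.η / 2) by ring,
    show -(l - P.η / 2) + P.ζ = P.ζ - (l - P.η / 2) by ring,
    show l - P.η / 2 + P.ζ = P.ζ + (l - P.η / 2) by ring, p, wb, wc, prefactor]
  generalize l - P.η / 2 = x at h ⊢
  generalize l + P.η / 2 = y at h ⊢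
  field_simp
  linear_combination -P.t4 P.ζ * P.t4 (2 * l + P.η) * h

theorem p_mul_offdiag {l : ℂ} (hl : P.Regular l) (hl' : P.Regular (-l)) (s r : ℂ) :
    P.p l * (P.t1 (2 * (-l - P.η / 2)) *
        (s * P.t4 (-l - P.η / 2) ^ 2 - r * P.t1 (-l - P.η / 2) ^ 2) /
        P.t4 (2 * (-l - P.η / 2))) =
      P.wd (2 * l) * (P.t1 (2 * (l - P.η / 2)) *
        (r * P.t4 (l - P.η / 2) ^ 2 - s * P.t1 (l - P.η / 2) ^ 2) /
        P.t4 (2 * (l - P.η / 2))) -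
      P.wa (2 * l) * (P.t1 (2 * (l - P.η / 2)) *
        (s * P.t4 (l - P.η / 2) ^ 2 - r * P.t1 (l - P.η / 2) ^ 2) /
        P.t4 (2 * (l - P.η / 2))) := by
  have h2 := P.theta2_ne_zero hω hζ
  have h4 := P.t4_zero_ne_zero hω hζ
  have h := P.t_boundary_offdiag hω hζ (l - P.η / 2) (l + P.η / 2) s r
  rw [Regular, show 2 * -l - P.η = -(2 * l + P.η) by ring, t4_neg] at hl'
  rw [Regular] at hl
  rw [show -l - P.η / 2 = -(l + P.η / 2) by ring,
    show 2 * -(l + P.η / 2) = -(2 * l + P.η) by ring,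
    show 2 * (l - P.η / 2) = 2 * l - P.η by ring, p, wa, wd, prefactor, t1_neg, t1_neg, t4_neg,
    t4_neg]
  rw [show 2 * (l - P.η / 2) = 2 * l - P.η by ring, show l + P.η / 2 - (l - P.η / 2) = P.η by ring,
    show l - P.η / 2 + (l + P.η / 2) = 2 * l by ring] at h
  generalize l - P.η / 2 = x at h ⊢
  generalize l + P.η / 2 = y at h ⊢
  field_simp
  linear_combination -P.t1 (2 * l - P.η) * P.t1 (2 * l + P.η) * h

omit hω hζ in
theorem K_01 (l : ℂ) : P.K l 0 1 = P.κ * P.t4 P.ζ ^ 3 / (P.t1 P.ζ * P.t4 0 ^ 2) *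
    (P.t1 (2 * l) * (Complex.exp P.τ * P.t4 l ^ 2 - Complex.exp (-P.τ) * P.t1 l ^ 2) /
      P.t4 (2 * l)) := by
  have e : Complex.exp (-P.τ) = Complex.exp P.τ * Complex.exp (-2 * P.τ) := by
    rw [← Complex.exp_add]
    congr 1
    ring
  simp only [K, Matrix.of_apply, Matrix.cons_val', Matrix.cons_val_zero,
    Matrix.cons_val_one, Matrix.cons_val_fin_one]
  rw [e, div_mul_div_comm]
  ring

omit hω hζ in
theorem K_10 (l : ℂ) : P.K l 1 0 = P.κ * P.t4 P.ζ ^ 3 / (P.t1 P.ζ * P.t4 0 ^ 2) *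
    (P.t1 (2 * l) * (Complex.exp (-P.τ) * P.t4 l ^ 2 - Complex.exp P.τ * P.t1 l ^ 2) /
      P.t4 (2 * l)) := by
  have e : Complex.exp P.τ = Complex.exp (-P.τ) * Complex.exp (2 * P.τ) := by
    rw [← Complex.exp_add]
    congr 1
    ring
  simp only [K, Matrix.of_apply, Matrix.cons_val', Matrix.cons_val_zero,
    Matrix.cons_val_one, Matrix.cons_val_fin_one]
  rw [e, div_mul_div_comm]
  ring

theorem p_mul_Kminus_01 {l : ℂ} (hl : P.Regular l) (hl' : P.Regular (-l)) :
    P.p l * P.Kminus (-l) 0 1 =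
      P.wd (2 * l) * P.Kminus l 1 0 - P.wa (2 * l) * P.Kminus l 0 1 := by
  rw [Kminus, Kminus, K_01, K_01, K_10]
  linear_combination P.κ * P.t4 P.ζ ^ 3 / (P.t1 P.ζ * P.t4 0 ^ 2) *
    P.p_mul_offdiag hω hζ hl hl' (Complex.exp P.τ) (Complex.exp (-P.τ))

theorem p_mul_Kminus_10 {l : ℂ} (hl : P.Regular l) (hl' : P.Regular (-l)) :
    P.p l * P.Kminus (-l) 1 0 =
      P.wd (2 * l) * P.Kminus l 0 1 - P.wa (2 * l) * P.Kminus l 1 0 := by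
  rw [Kminus, Kminus, K_10, K_10, K_01]
  linear_combination P.κ * P.t4 P.ζ ^ 3 / (P.t1 P.ζ * P.t4 0 ^ 2) *
    P.p_mul_offdiag hω hζ hl hl' (Complex.exp (-P.τ)) (Complex.exp P.τ)

end

/-- Under λ → -λ the diagonal entries are exchanged and the off-diagonal ones, through θ₁(2λ),
change sign. -/
theorem K_neg (l : ℂ) : P.K (-l) = (P.K l).adjugate := by
  ext i j
  rw [Matrix.adjugate_fin_two]
  fin_cases i <;> fin_cases j
  · simp [K]
    ring
  · simp only [Fin.zero_eta, Fin.mk_one, K_01]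
    simp [t1_neg, t4_neg]
    ring
  · simp only [Fin.zero_eta, Fin.mk_one, K_10]
    simp [t1_neg, t4_neg]
    ring
  · simp [K]
    ring

end Chain

/-! ### Algebra of the `2 × 2` blocks in the auxiliary space -/

section Blocks

variable {A : Type*} [Ring A] [Algebra ℂ A]

/-- The eight-vertex matrix as a block matrix, with `e` the matrix units of the quantum space. -/
def vertexBlocks (e : Fin 2 → Fin 2 → A) (a b c d : ℂ) : Matrix (Fin 2) (Fin 2) A :=
  !![a • e 0 0 + b • e 1 1, d • e 0 1 + c • e 1 0;
     c • e 0 1 + d • e 1 0, b • e 0 0 + a • e 1 1]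

/-- The linear map on `2 × 2` block matrices that reverses the spectral parameter of a
boundary monodromy matrix. -/
def parityMap (a b c d : ℂ) (X : Matrix (Fin 2) (Fin 2) A) : Matrix (Fin 2) (Fin 2) A :=
  !![b • X 1 1 - c • X 0 0, d • X 1 0 - a • X 0 1;
     d • X 0 1 - a • X 1 0, b • X 0 0 - c • X 1 1]

/-- Conjugation by `σ^y` of the transpose in the auxiliary space, on block matrices. -/
def crossing (X : Matrix (Fin 2) (Fin 2) A) : Matrix (Fin 2) (Fin 2) A :=
  !![X 1 1, -X 0 1; -X 1 0, X 0 0]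

theorem crossing_vertexBlocks (e : Fin 2 → Fin 2 → A) (a b c d : ℂ) :
    crossing (vertexBlocks e a b c d) = -vertexBlocks e (-b) (-a) c d := by
  ext i j
  fin_cases i <;> fin_cases j <;> simp [crossing, vertexBlocks] <;> abel

omit [Algebra ℂ A] in
-- `crossing` has the shape of the 2×2 adjugate, which reverses products; for this it suffices that
-- the entries of one factor commute with those of the other.
theorem crossing_mul (X Y : Matrix (Fin 2) (Fin 2) A)
    (h : ∀ i j k l, Commute (X i j) (Y k l)) :
    crossing (X * Y) = crossing Y * crossing X := by
  ext i j
  fin_cases i <;> fin_cases j <;>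
    simp [crossing, Matrix.mul_apply, Fin.sum_univ_two, (h _ _ _ _).eq] <;> abel

omit [Algebra ℂ A] in
theorem crossing_one : crossing (1 : Matrix (Fin 2) (Fin 2) A) = 1 := by
  ext i j
  fin_cases i <;> fin_cases j <;> simp [crossing]

variable (e : Fin 2 → Fin 2 → A)
  (he : ∀ s t u v, e s t * e u v = if t = u then e s v else 0)
include he

theorem vertexBlocks_mul_eq_smul_one (hone : e 0 0 + e 1 1 = 1) {a b c d a' b' c' d' r : ℂ}
    (h1 : a * a' + d * d' = r) (h2 : b * b' + c * c' = r) (h3 : a * d' + d * a' = 0)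
    (h4 : b * c' + c * b' = 0) :
    vertexBlocks e a b c d * vertexBlocks e a' b' c' d' = r • 1 := by
  have hr : r • (1 : A) = r • e 0 0 + r • e 1 1 := by rw [← hone, smul_add]
  ext i j
  fin_cases i <;> fin_cases j <;>
    simp [vertexBlocks, Matrix.mul_apply, Fin.sum_univ_two, add_mul, mul_add, he, hr,
      Matrix.smul_apply] <;>
    match_scalars <;> first | linear_combination h1 | linear_combination h2 |
      linear_combination h3 | linear_combination h4

set_option maxHeartbeats 2000000 in
-- The inductive step for adding one site: unprimed weights are taken at u, primed at v, doubly
-- primed at u+v+η, and the right side carries the crossed weights at -v-η and -u-η. Since X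
-- commutes with the matrix units, both sides expand in the products of an entry of X and an `e s
-- t`, and the hypotheses are what the coefficients require. The first two are symmetric in u and v
-- up to sign, so only `h3` and `h4` need exchanged versions.
theorem parityMap_conj {a b c d a' b' c' d' a'' b'' c'' d'' : ℂ}
    (h1 : b'' * (c * c' - d * d') = c'' * (a * a' - b * b'))
    (h2 : a'' * (d * c' - c * d') = d'' * (b * a' - a * b'))
    (h3 : c * (b'' * a' - a'' * b') = a * (c'' * c' - d'' * d'))
    (h4 : d * (a'' * a' - b'' * b') = b * (d'' * c' - c'' * d'))
    (h5 : c' * (b'' * a - a'' * b) = a' * (c'' * c - d'' * d))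
    (h6 : d' * (a'' * a - b'' * b) = b' * (d'' * c - c'' * d))
    (X : Matrix (Fin 2) (Fin 2) A) (hX : ∀ i j s t, e s t * X i j = X i j * e s t) :
    parityMap a'' b'' c'' d'' (vertexBlocks e a b c d * X * vertexBlocks e a' b' c' d') =
      vertexBlocks e (-b') (-a') c' d' * parityMap a'' b'' c'' d'' X *
        vertexBlocks e (-b) (-a) c d := by
  ext i j
  fin_cases i <;> fin_cases j <;>
    simp [parityMap, vertexBlocks, Matrix.mul_apply, Fin.sum_univ_two, add_mul, mul_add,
      sub_mul, mul_sub, Matrix.vecMul, dotProduct, he, hX, mul_assoc] <;>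
    match_scalars <;> first | ring1 | linear_combination h1 | linear_combination -h1 |
      linear_combination h2 | linear_combination -h2 | linear_combination h3 |
      linear_combination -h3 | linear_combination h4 | linear_combination -h4 |
      linear_combination h5 | linear_combination -h5 | linear_combination h6 |
      linear_combination -h6

end Blocks

/-! ### Operators on the chain -/

section Sites

variable {N : ℕ}

/-- The matrix unit `E_{st}` acting at the site `n`. -/
def siteUnit (n : Fin N) (s t : Fin 2) : ChainOp N :=
  Matrix.of fun x y => if x n = s ∧ Function.update x n t = y then 1 else 0

theorem siteUnit_apply (n : Fin N) (s t : Fin 2) (x y : Site N) :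
    siteUnit n s t x y = if x n = s ∧ Function.update x n t = y then 1 else 0 := rfl

theorem siteUnit_mul_apply (n : Fin N) (s t : Fin 2) (X : ChainOp N) (x y : Site N) :
    (siteUnit n s t * X) x y = if x n = s then X (Function.update x n t) y else 0 := by
  rw [Matrix.mul_apply, Finset.sum_eq_single (Function.update x n t)]
  · by_cases h : x n = s <;> simp [siteUnit_apply, h]
  · intro z _ hz
    simp [siteUnit_apply, hz.symm]
  · simp

theorem siteUnit_mul_self (n : Fin N) (s t u v : Fin 2) :
    siteUnit n s t * siteUnit n u v = if t = u then siteUnit n s v else 0 := by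
  ext x y
  rw [siteUnit_mul_apply]
  by_cases h : x n = s <;> by_cases h' : t = u <;> simp [siteUnit_apply, h, h']

theorem siteUnit_add (n : Fin N) : siteUnit n 0 0 + siteUnit n 1 1 = 1 := by
  ext x y
  rcases Fin.exists_fin_two.mp ⟨x n, rfl⟩ with h | h
  · have e : Function.update x n 0 = x := by rw [← h, Function.update_eq_self]
    simp [siteUnit_apply, h, e, Matrix.one_apply]
  · have e : Function.update x n 1 = x := by rw [← h, Function.update_eq_self]
    simp [siteUnit_apply, h, e, Matrix.one_apply]

theorem siteUnit_commute {n m : Fin N} (h : n ≠ m) (s t u v : Fin 2) :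
    Commute (siteUnit n s t) (siteUnit m u v) := by
  ext x y
  rw [siteUnit_mul_apply, siteUnit_mul_apply]
  simp only [siteUnit_apply, Function.update_of_ne h, Function.update_of_ne h.symm,
    Function.update_comm h]
  by_cases h1 : x n = s <;> by_cases h2 : x m = u <;> simp [h1, h2]

variable (N) in
/-- Operators on `R_0 ⊗ R_N` as `2 × 2` matrices of operators on `R_N`. -/
def blocks : AuxOp N ≃ₐ[ℂ] Matrix (Fin 2) (Fin 2) (ChainOp N) :=
  (Matrix.compAlgEquiv (Fin 2) (Site N) ℂ ℂ).symm

theorem blocks_apply (X : AuxOp N) (i j : Fin 2) (x y : Site N) :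
    blocks N X i j x y = X (i, x) (j, y) := rfl

theorem blocks_onSite (n : Fin N) (P : Chain N) (u : ℂ) :
    blocks N (onSite n (P.R u)) =
      vertexBlocks (siteUnit n) (P.wa u) (P.wb u) (P.wc u) (P.wd u) := by
  have hk : ∀ (x y : Site N) (t : Fin 2), Function.update x n t = y ↔
      (∀ m, m ≠ n → x m = y m) ∧ y n = t := by
    intro x y t
    rw [Function.update_eq_iff, and_comm, eq_comm (a := t)]
  have f00 : (finProdFinEquiv ((0 : Fin 2), (0 : Fin 2)) : Fin (2 * 2)) = 0 := by decide
  have f01 : (finProdFinEquiv ((0 : Fin 2), (1 : Fin 2)) : Fin (2 * 2)) = 1 := by decide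
  have f10 : (finProdFinEquiv ((1 : Fin 2), (0 : Fin 2)) : Fin (2 * 2)) = 2 := by decide
  have f11 : (finProdFinEquiv ((1 : Fin 2), (1 : Fin 2)) : Fin (2 * 2)) = 3 := by decide
  ext i j x y
  rw [blocks_apply]
  by_cases h : ∀ m, m ≠ n → x m = y m
  · rcases Fin.exists_fin_two.mp ⟨x n, rfl⟩ with hx | hx <;>
    rcases Fin.exists_fin_two.mp ⟨y n, rfl⟩ with hy | hy <;>
    fin_cases i <;> fin_cases j <;>
    simp [onSite, vertexBlocks, siteUnit_apply, hk, hx, hy, Chain.R, f00, f01, f10, f11]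
  · fin_cases i <;> fin_cases j <;>
    simp [onSite, vertexBlocks, siteUnit_apply, hk, h]

theorem blocks_scalar (X : Matrix (Fin 2) (Fin 2) ℂ) :
    blocks N (X ⊗ₖ (1 : ChainOp N)) = X.map (algebraMap ℂ (ChainOp N)) := by
  ext i j x y
  simp [blocks_apply, Matrix.kroneckerMap_apply, Matrix.algebraMap_eq_diagonal,
    Matrix.diagonal_apply, Matrix.one_apply]

theorem blocks_sigmaY_conj_auxTranspose (X : AuxOp N) :
    blocks N ((sigmaY ⊗ₖ (1 : ChainOp N)) * auxTranspose X * (sigmaY ⊗ₖ (1 : ChainOp N))) =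
      crossing (blocks N X) := by
  have ht : blocks N (auxTranspose X) = (blocks N X).transpose := rfl
  have hI : (algebraMap ℂ (ChainOp N)) Complex.I * (algebraMap ℂ (ChainOp N)) Complex.I = -1 := by
    rw [← map_mul, Complex.I_mul_I, map_neg, map_one]
  rw [map_mul, map_mul, blocks_scalar, ht]
  ext1 i j
  fin_cases i <;> fin_cases j <;>
    simp [sigmaY, crossing, Matrix.mul_apply, Fin.sum_univ_two, ← Algebra.commutes Complex.I,
      ← mul_assoc, hI]

end Sites

/-! ### The boundary monodromy matrix -/

section Monodromy

variable {N : ℕ}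

/-- All entries of a block matrix commute with the operators acting at the site `m`. -/
def CommutesAt (m : Fin N) (X : Matrix (Fin 2) (Fin 2) (ChainOp N)) : Prop :=
  ∀ i j s t, Commute (siteUnit m s t) (X i j)

theorem CommutesAt.mul {m : Fin N} {X Y : Matrix (Fin 2) (Fin 2) (ChainOp N)}
    (hX : CommutesAt m X) (hY : CommutesAt m Y) : CommutesAt m (X * Y) := by
  intro i j s t
  rw [Matrix.mul_apply]
  exact Commute.sum_right _ _ _ fun k _ => (hX i k s t).mul_right (hY k j s t)

theorem commutesAt_scalar (m : Fin N) (X : Matrix (Fin 2) (Fin 2) ℂ) :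
    CommutesAt m (X.map (algebraMap ℂ (ChainOp N))) := by
  intro i j s t
  rw [Matrix.map_apply]
  exact (Algebra.commutes (X i j) (siteUnit m s t)).symm

theorem commutesAt_one (m : Fin N) : CommutesAt m 1 := by
  have := commutesAt_scalar m 1
  rwa [Matrix.map_one _ (map_zero _) (map_one _)] at this

theorem commute_vertexBlocks {e : Fin 2 → Fin 2 → ChainOp N} {x : ChainOp N}
    (h : ∀ s t, Commute x (e s t)) (a b c d : ℂ) (i j : Fin 2) :
    Commute x (vertexBlocks e a b c d i j) := by
  fin_cases i <;> fin_cases j <;>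
    exact ((h _ _).smul_right _).add_right ((h _ _).smul_right _)

theorem commutesAt_vertexBlocks {m n : Fin N} (h : m ≠ n) (a b c d : ℂ) :
    CommutesAt m (vertexBlocks (siteUnit n) a b c d) :=
  fun i j s t => commute_vertexBlocks (fun u v => siteUnit_commute h s t u v) a b c d i j

variable (P : Chain N)

/-- The block form of the R-matrix acting on `R_0 ⊗ R_n`. -/
def siteBlocks (n : Fin N) (u : ℂ) : Matrix (Fin 2) (Fin 2) (ChainOp N) :=
  vertexBlocks (siteUnit n) (P.wa u) (P.wb u) (P.wc u) (P.wd u)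

theorem crossing_siteBlocks (n : Fin N) (u : ℂ) :
    crossing (siteBlocks P n u) = -siteBlocks P n (-u - P.η) := by
  rw [siteBlocks, crossing_vertexBlocks, siteBlocks, P.wa_crossing, P.wb_crossing, P.wc_crossing,
    P.wd_crossing]

/-- The scalar boundary matrix dressed by the sites of a list, the last one innermost. -/
def dressed (l : ℂ) : List (Fin N) → Matrix (Fin 2) (Fin 2) (ChainOp N)
  | [] => (P.Kminus l).map (algebraMap ℂ (ChainOp N))
  | n :: L => siteBlocks P n (l - P.ξ n - P.η / 2) * dressed l L *
      siteBlocks P n (l + P.ξ n - P.η / 2)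

theorem commutesAt_dressed (l : ℂ) {m : Fin N} :
    ∀ {L : List (Fin N)}, m ∉ L → CommutesAt m (dressed P l L)
  | [], _ => commutesAt_scalar m _
  | n :: L, h => by
    rw [List.mem_cons, not_or] at h
    exact ((commutesAt_vertexBlocks h.1 _ _ _ _).mul (commutesAt_dressed l h.2)).mul
      (commutesAt_vertexBlocks h.1 _ _ _ _)

theorem commutesAt_prod (f : Fin N → ℂ) {m : Fin N} :
    ∀ {L : List (Fin N)}, m ∉ L →
      CommutesAt m (L.map fun n => siteBlocks P n (f n)).prod
  | [], _ => commutesAt_one m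
  | n :: L, h => by
    rw [List.mem_cons, not_or] at h
    rw [List.map_cons, List.prod_cons]
    exact (commutesAt_vertexBlocks h.1 _ _ _ _).mul (commutesAt_prod f h.2)

/-- Without repetitions the factors act on distinct sites, so their entries commute and
`crossing_mul` applies; each factor contributes one sign. -/
theorem crossing_prod (f : Fin N → ℂ) :
    ∀ {L : List (Fin N)}, L.Nodup →
      crossing (L.map fun n => siteBlocks P n (f n)).prod =
        (-1 : ℂ) ^ L.length • (L.reverse.map fun n => siteBlocks P n (-f n - P.η)).prod
  | [], _ => by simp [crossing_one]
  | n :: L, h => by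
    rw [List.nodup_cons] at h
    have hc : ∀ i j k l, Commute (siteBlocks P n (f n) i j)
        ((L.map fun n => siteBlocks P n (f n)).prod k l) := fun i j k l =>
      (commute_vertexBlocks (fun s t => (commutesAt_prod P f h.1 k l s t).symm) _ _ _ _
        i j).symm
    rw [List.map_cons, List.prod_cons, crossing_mul _ _ hc, crossing_prod f h.2,
      crossing_siteBlocks]
    simp [pow_succ]

theorem dressed_eq (l : ℂ) (L : List (Fin N)) :
    dressed P l L = (L.map fun n => siteBlocks P n (l - P.ξ n - P.η / 2)).prod *
      (P.Kminus l).map (algebraMap ℂ (ChainOp N)) *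
      (L.reverse.map fun n => siteBlocks P n (l + P.ξ n - P.η / 2)).prod := by
  induction L with
  | nil => simp [dressed]
  | cons n L ih => simp [dressed, ih, mul_assoc]

theorem blocks_M (l : ℂ) : blocks N (P.M l) =
    ((List.finRange N).reverse.map fun n => siteBlocks P n (l - P.ξ n - P.η / 2)).prod := by
  rw [Chain.M, map_list_prod, List.map_map]
  simp only [Function.comp_def, blocks_onSite, siteBlocks]

theorem blocks_Mhat (l : ℂ) : blocks N (P.Mhat l) =
    ((List.finRange N).map fun n => siteBlocks P n (l + P.ξ n - P.η / 2)).prod := by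
  rw [Chain.Mhat, map_smul, blocks_sigmaY_conj_auxTranspose, blocks_M,
    crossing_prod P _ (List.nodup_reverse.mpr (List.nodup_finRange N)), List.reverse_reverse,
    List.length_reverse, List.length_finRange, smul_smul, ← mul_pow, neg_one_mul, neg_neg,
    one_pow, one_smul]
  congr 2
  funext n
  congr 1
  ring

theorem blocks_U (l : ℂ) : blocks N (P.U l) = dressed P l (List.finRange N).reverse := by
  rw [dressed_eq, Chain.U, map_mul, map_mul, blocks_M, blocks_Mhat, blocks_scalar,
    List.reverse_reverse]

variable (hω : 0 < P.ω.im) (hζ : P.t1 P.ζ ≠ 0)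
include hω hζ

theorem parityMap_dressed {l : ℂ} (hl : P.Regular l) (hl' : P.Regular (-l)) :
    ∀ {L : List (Fin N)}, L.Nodup →
      parityMap (P.wa (2 * l)) (P.wb (2 * l)) (P.wc (2 * l)) (P.wd (2 * l)) (dressed P l L) =
        P.p l • dressed P (-l) L
  | [], _ => by
    have h00 := congrArg (algebraMap ℂ (ChainOp N)) (P.p_mul_Kminus_00 hω hζ l)
    have h11 := congrArg (algebraMap ℂ (ChainOp N)) (P.p_mul_Kminus_11 hω hζ l)
    have h01 := congrArg (algebraMap ℂ (ChainOp N)) (P.p_mul_Kminus_01 hω hζ hl hl')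
    have h10 := congrArg (algebraMap ℂ (ChainOp N)) (P.p_mul_Kminus_10 hω hζ hl hl')
    simp only [map_sub, map_mul] at h00 h11 h01 h10
    ext1 i j
    fin_cases i <;> fin_cases j <;>
      simp [parityMap, dressed, Algebra.smul_def, h00, h11, h01, h10]
  | n :: L, h => by
    rw [List.nodup_cons] at h
    have ih := parityMap_dressed hl hl' h.2
    -- The crossed parameters -v-η and -u-η are exactly the left and right dressing parameters at
    -- -l, and u+v+η = 2l does not depend on the inhomogeneity.
    set u := l - P.ξ n - P.η / 2 with hu
    set v := l + P.ξ n - P.η / 2 with hv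
    have hw : u + v + P.η = 2 * l := by rw [hu, hv]; ring
    have hw' : v + u + P.η = 2 * l := by rw [← hw, add_comm v u]
    have e1 : -l - P.ξ n - P.η / 2 = -v - P.η := by rw [hv]; ring
    have e2 : -l + P.ξ n - P.η / 2 = -u - P.η := by rw [hu]; ring
    have h1 := P.yangBaxter_bc hω u v
    have h2 := P.yangBaxter_ad hω u v
    have h3 := P.yangBaxter_ca hω u v
    have h4 := P.yangBaxter_db hω u v
    have h5 := P.yangBaxter_ca hω v u
    have h6 := P.yangBaxter_db hω v u
    rw [hw] at h1 h2 h3 h4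
    rw [hw'] at h5 h6
    rw [dressed, dressed, siteBlocks, siteBlocks, parityMap_conj (siteUnit n)
      (siteUnit_mul_self n) h1 h2 h3 h4 h5 h6 _
      (fun i j s t => (commutesAt_dressed P l h.1 i j s t).eq), ih, e1, e2, siteBlocks, siteBlocks,
      P.wa_crossing, P.wb_crossing, P.wc_crossing, P.wd_crossing, P.wa_crossing, P.wb_crossing,
      P.wc_crossing, P.wd_crossing, Matrix.mul_smul, Matrix.smul_mul]

theorem siteBlocks_mul_neg (n : Fin N) (u : ℂ) :
    siteBlocks P n u * siteBlocks P n (-u) = (P.theta (P.η + u) * P.theta (P.η - u)) • 1 :=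
  vertexBlocks_mul_eq_smul_one (siteUnit n) (siteUnit_mul_self n) (siteUnit_add n)
    (P.wa_wa_add_wd_wd hω hζ u) (P.wb_wb_add_wc_wc hω hζ u) (P.wa_wd_add_wd_wa u)
    (P.wb_wc_add_wc_wb u)

/-- The value of `det_q U₋(λ) / p(λ - η/2)` on the scalar boundary matrix dressed by a list of
sites. -/
theorem dressed_mul_dressed (l : ℂ) (L : List (Fin N)) :
    dressed P (l + P.η / 2) L * dressed P (P.η / 2 - l) L =
      ((P.K l).det * (L.map fun n =>
        (P.theta (P.η + (l + P.ξ n)) * P.theta (P.η - (l + P.ξ n))) *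
        (P.theta (P.η + (l - P.ξ n)) * P.theta (P.η - (l - P.ξ n)))).prod) • 1 := by
  induction L with
  | nil =>
    rw [dressed, dressed, Chain.Kminus, Chain.Kminus, ← Matrix.map_mul, add_sub_cancel_right,
      show P.η / 2 - l - P.η / 2 = -l by ring, P.K_neg, Matrix.mul_adjugate]
    ext1 i j
    fin_cases i <;> fin_cases j <;> simp [Algebra.algebraMap_eq_smul_one]
  | cons n L ih =>
    rw [dressed, dressed, show l + P.η / 2 - P.ξ n - P.η / 2 = l - P.ξ n by ring,
      show l + P.η / 2 + P.ξ n - P.η / 2 = l + P.ξ n by ring,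
      show P.η / 2 - l - P.ξ n - P.η / 2 = -(l + P.ξ n) by ring,
      show P.η / 2 - l + P.ξ n - P.η / 2 = -(l - P.ξ n) by ring]
    set X := dressed P (l + P.η / 2) L
    set Y := dressed P (P.η / 2 - l) L
    -- The adjacent inner R-matrices have opposite arguments and give a scalar; by induction X * Y
    -- is then a scalar too, which brings the outer pair together.
    calc siteBlocks P n (l - P.ξ n) * X * siteBlocks P n (l + P.ξ n) *
          (siteBlocks P n (-(l + P.ξ n)) * Y * siteBlocks P n (-(l - P.ξ n)))
        = siteBlocks P n (l - P.ξ n) * X *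
            (siteBlocks P n (l + P.ξ n) * siteBlocks P n (-(l + P.ξ n))) * Y *
            siteBlocks P n (-(l - P.ξ n)) := by simp only [mul_assoc]
      _ = (P.theta (P.η + (l + P.ξ n)) * P.theta (P.η - (l + P.ξ n))) •
            (siteBlocks P n (l - P.ξ n) * (X * Y) * siteBlocks P n (-(l - P.ξ n))) := by
          rw [siteBlocks_mul_neg P hω hζ]
          simp only [Matrix.mul_smul, Matrix.smul_mul, mul_one, mul_assoc]
      _ = _ := by
          rw [ih]
          simp only [Matrix.mul_smul, Matrix.smul_mul, mul_one, siteBlocks_mul_neg P hω hζ,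
            smul_smul, List.map_cons, List.prod_cons]
          congr 1
          ring

end Monodromy

/-! ### The quantum determinant -/

namespace Chain

variable {N : ℕ} (P : Chain N)

/-- The scalar by which `det_q U₋(λ) / p(λ - η/2)` acts. -/
def qdetScalar (l : ℂ) : ℂ :=
  (P.K l).det * ∏ n, (P.theta (P.η + (l + P.ξ n)) * P.theta (P.η - (l + P.ξ n))) *
    (P.theta (P.η + (l - P.ξ n)) * P.theta (P.η - (l - P.ξ n)))

theorem qdetScalar_neg (l : ℂ) : P.qdetScalar (-l) = P.qdetScalar l := by
  have hd : (P.K (-l)).det = (P.K l).det := by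
    rw [K_neg, Matrix.det_adjugate]
    simp
  rw [qdetScalar, qdetScalar, hd]
  congr 1
  refine Finset.prod_congr rfl fun n _ => ?_
  rw [show P.η + (-l + P.ξ n) = P.η - (l - P.ξ n) by ring,
    show P.η - (-l + P.ξ n) = P.η + (l - P.ξ n) by ring,
    show P.η + (-l - P.ξ n) = P.η - (l + P.ξ n) by ring,
    show P.η - (-l - P.ξ n) = P.η + (l + P.ξ n) by ring]
  ring

variable (hω : 0 < P.ω.im) (hζ : P.t1 P.ζ ≠ 0)
include hω hζ

theorem blocks_U_mul_blocks_U (l : ℂ) :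
    blocks N (P.U (l + P.η / 2)) * blocks N (P.U (P.η / 2 - l)) = P.qdetScalar l • 1 := by
  rw [blocks_U, blocks_U, dressed_mul_dressed P hω hζ, qdetScalar, List.map_reverse,
    List.prod_reverse, ← List.ofFn_eq_map, List.prod_ofFn]

theorem U_mul_U (l : ℂ) :
    P.U (l + P.η / 2) * P.U (P.η / 2 - l) = P.qdetScalar l • 1 := by
  apply (blocks N).injective
  rw [map_mul, P.blocks_U_mul_blocks_U hω hζ, map_smul, map_one]

theorem A_mul_A_add_B_mul_C (l : ℂ) :
    P.A (l + P.η / 2) * P.A (P.η / 2 - l) + P.B (l + P.η / 2) * P.C (P.η / 2 - l) =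
      P.qdetScalar l • 1 := by
  have h := congrFun₂ (P.blocks_U_mul_blocks_U hω hζ l) 0 0
  rw [Matrix.mul_apply, Fin.sum_univ_two] at h
  exact h

theorem D_mul_D_add_C_mul_B (l : ℂ) :
    P.D (l + P.η / 2) * P.D (P.η / 2 - l) + P.C (l + P.η / 2) * P.B (P.η / 2 - l) =
      P.qdetScalar l • 1 := by
  have h := congrFun₂ (P.blocks_U_mul_blocks_U hω hζ l) 1 1
  rw [Matrix.mul_apply, Fin.sum_univ_two, add_comm] at h
  exact h

theorem qdet_eq (l : ℂ) : P.qdet l = (P.p (l - P.η / 2) * P.qdetScalar l) • 1 := by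
  rw [qdet, qdetOverP, P.A_mul_A_add_B_mul_C hω hζ, smul_smul]

theorem parityMap_U {l : ℂ} (hl : P.Regular l) (hl' : P.Regular (-l)) :
    parityMap (P.wa (2 * l)) (P.wb (2 * l)) (P.wc (2 * l)) (P.wd (2 * l)) (blocks N (P.U l)) =
      P.p l • blocks N (P.U (-l)) := by
  rw [blocks_U, blocks_U]
  exact parityMap_dressed P hω hζ hl hl' (List.nodup_reverse.mpr (List.nodup_finRange N))

/-! The product of the two values of `g₋`. -/

omit hω hζ in
theorem k_mul_sn_sq (hk : P.sqrtk ≠ 0) (u : ℂ) : P.k * P.sn u ^ 2 = P.t1 u ^ 2 / P.t4 u ^ 2 := by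
  rw [k, sn]
  field_simp

omit hω hζ in
theorem sn_neg (u : ℂ) : P.sn (-u) = -P.sn u := by
  rw [sn, sn, t1_neg, t4_neg]
  ring

/-- Under x → -x both radicands are unchanged while `sn (2x)` changes sign. The product is thus a
difference of squares, in which the branch disappears; the two squares match K₁₁K₂₂ and K₁₂K₂₁. -/
theorem g_mul_g (sqrt : ℂ → ℂ) (hs : ∀ z, sqrt z ^ 2 = z) {x : ℂ} (h2x : P.t4 (2 * x) ≠ 0)
    (h4ζ : P.t4 P.ζ ≠ 0) (h4 : P.t4 x ≠ 0) (hp : P.t4 (x + P.ζ) ≠ 0) (hm : P.t4 (x - P.ζ) ≠ 0) :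
    P.g sqrt (x + P.η / 2) * P.g sqrt (-x + P.η / 2) = (P.K x).det := by
  have hk := P.sqrtk_ne_zero hω hζ
  have h0 := P.t4_zero_ne_zero hω hζ
  -- This is where θ₄(x±ζ) ≠ 0 makes the denominator of g₋ nonzero.
  have hden : 1 - P.k ^ 2 * P.sn P.ζ ^ 2 * P.sn x ^ 2 =
      P.t4 0 ^ 2 * (P.t4 (x + P.ζ) * P.t4 (x - P.ζ)) / (P.t4 x ^ 2 * P.t4 P.ζ ^ 2) := by
    rw [P.t4_add_mul_t4_sub hω, show P.k ^ 2 * P.sn P.ζ ^ 2 * P.sn x ^ 2 =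
      (P.k * P.sn P.ζ ^ 2) * (P.k * P.sn x ^ 2) by ring, P.k_mul_sn_sq hk, P.k_mul_sn_sq hk]
    field_simp
  have hnum : ∀ s, 1 - P.k * s * P.sn x ^ 2 = (P.t4 x ^ 2 - s * P.t1 x ^ 2) / P.t4 x ^ 2 := by
    intro s
    rw [mul_right_comm, P.k_mul_sn_sq hk]
    field_simp
  have hdet : (P.K x).det = P.K x 0 0 * P.K x 1 1 - P.K x 0 1 * P.K x 1 0 :=
    Matrix.det_fin_two _
  have e1 : P.g sqrt (x + P.η / 2) = P.h x / P.sn P.ζ *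
      (sqrt (P.sn (x + P.ζ) * P.sn (P.ζ - x)) + P.κ * P.sn (2 * x) *
        sqrt ((1 - P.k * Complex.exp (2 * P.τ) * P.sn x ^ 2) *
          (1 - P.k * Complex.exp (-2 * P.τ) * P.sn x ^ 2)) /
        (1 - P.k ^ 2 * P.sn P.ζ ^ 2 * P.sn x ^ 2)) := by
    rw [g, add_sub_cancel_right, show x + P.η / 2 + P.ζ - P.η / 2 = x + P.ζ by ring,
      show -(x + P.η / 2) + P.ζ + P.η / 2 = P.ζ - x by ring,
      show 2 * (x + P.η / 2) - P.η = 2 * x by ring]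
  have e2 : P.g sqrt (-x + P.η / 2) = P.h x / P.sn P.ζ *
      (sqrt (P.sn (x + P.ζ) * P.sn (P.ζ - x)) - P.κ * P.sn (2 * x) *
        sqrt ((1 - P.k * Complex.exp (2 * P.τ) * P.sn x ^ 2) *
          (1 - P.k * Complex.exp (-2 * P.τ) * P.sn x ^ 2)) /
        (1 - P.k ^ 2 * P.sn P.ζ ^ 2 * P.sn x ^ 2)) := by
    have eh : P.h (-x) = P.h x := by
      rw [h, h, ← P.t4_neg (-x + P.ζ), ← P.t4_neg (-x - P.ζ), mul_comm]
      congr 2 <;> ring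
    rw [g, add_sub_cancel_right, show -x + P.η / 2 + P.ζ - P.η / 2 = P.ζ - x by ring,
      show -(-x + P.η / 2) + P.ζ + P.η / 2 = x + P.ζ by ring,
      show 2 * (-x + P.η / 2) - P.η = -(2 * x) by ring, P.sn_neg, P.sn_neg, neg_sq, eh,
      mul_comm (P.sn (P.ζ - x))]
    ring
  have hK : P.K x 0 1 * P.K x 1 0 = P.κ ^ 2 * P.t1 (2 * x) ^ 2 *
      ((P.t4 x ^ 2 - Complex.exp (2 * P.τ) * P.t1 x ^ 2) *
        (P.t4 x ^ 2 - Complex.exp (-2 * P.τ) * P.t1 x ^ 2)) * P.t4 P.ζ ^ 6 /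
      (P.t1 P.ζ ^ 2 * P.t4 0 ^ 4 * P.t4 (2 * x) ^ 2) := by
    have hE : Complex.exp P.τ * Complex.exp (-P.τ) = 1 := by
      rw [← Complex.exp_add, add_neg_cancel, Complex.exp_zero]
    simp only [K, Matrix.of_apply, Matrix.cons_val', Matrix.cons_val_zero,
      Matrix.cons_val_one, Matrix.cons_val_fin_one]
    rw [div_mul_div_comm]
    linear_combination P.κ ^ 2 * P.t1 (2 * x) ^ 2 *
      ((P.t4 x ^ 2 - Complex.exp (2 * P.τ) * P.t1 x ^ 2) *
        (P.t4 x ^ 2 - Complex.exp (-2 * P.τ) * P.t1 x ^ 2)) * P.t4 P.ζ ^ 6 /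
      (P.t1 P.ζ ^ 2 * P.t4 0 ^ 4 * P.t4 (2 * x) ^ 2) * hE
  have hKd : P.K x 0 0 * P.K x 1 1 = P.t4 P.ζ ^ 2 / P.t1 P.ζ ^ 2 *
      (P.t4 (x - P.ζ) * P.t4 (x + P.ζ) * (P.t1 (P.ζ - x) * P.t1 (x + P.ζ))) := by
    rw [← P.t4_neg (x - P.ζ), neg_sub]
    simp only [K, Matrix.of_apply, Matrix.cons_val', Matrix.cons_val_zero,
      Matrix.cons_val_one, Matrix.cons_val_fin_one]
    rw [neg_add_eq_sub]
    ring
  rw [e1, e2, mul_mul_mul_comm, ← sq_sub_sq, hs, div_pow, mul_pow, hs, hnum, hnum, hden, hdet,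
    hK, hKd, h]
  simp only [sn]
  rw [← P.t4_neg (P.ζ - x), neg_sub]
  generalize (P.t4 x ^ 2 - Complex.exp (2 * P.τ) * P.t1 x ^ 2) = F
  generalize (P.t4 x ^ 2 - Complex.exp (-2 * P.τ) * P.t1 x ^ 2) = G
  generalize P.t4 (x - P.ζ) = y1 at *
  generalize P.t4 (x + P.ζ) = y2 at *
  generalize P.t1 (x + P.ζ) = y3 at *
  generalize P.t1 (P.ζ - x) = y4 at *
  field_simp

theorem qdetScalar_eq (sqrt : ℂ → ℂ) (hs : ∀ z, sqrt z ^ 2 = z) {l : ℂ}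
    (h2l : P.t4 (2 * l) ≠ 0) (h4ζ : P.t4 P.ζ ≠ 0) (h4 : P.t4 l ≠ 0) (hp : P.t4 (l + P.ζ) ≠ 0)
    (hm : P.t4 (l - P.ζ) ≠ 0) :
    P.qdetScalar l = P.Ahat sqrt (l + P.η / 2) * P.Ahat sqrt (-l + P.η / 2) := by
  have hprod : (∏ n, (P.theta (P.η + (l + P.ξ n)) * P.theta (P.η - (l + P.ξ n))) *
      (P.theta (P.η + (l - P.ξ n)) * P.theta (P.η - (l - P.ξ n)))) =
      P.bulkA (l + P.η / 2) * P.bulkD (-(l + P.η / 2)) *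
        (P.bulkA (-l + P.η / 2) * P.bulkD (-(-l + P.η / 2))) := by
    simp only [bulkD, bulkA, ← Finset.prod_mul_distrib]
    refine Finset.prod_congr rfl fun n _ => ?_
    -- The two factors of `bulkD` come with negated arguments; θ is odd, and the two signs cancel at
    -- each site.
    rw [show l + P.η / 2 - P.ξ n + P.η / 2 = P.η + (l - P.ξ n) by ring,
      show -(l + P.η / 2) - P.η - P.ξ n + P.η / 2 = -(P.η + (l + P.ξ n)) by ring,
      show -l + P.η / 2 - P.ξ n + P.η / 2 = P.η - (l + P.ξ n) by ring,
      show -(-l + P.η / 2) - P.η - P.ξ n + P.η / 2 = -(P.η - (l - P.ξ n)) by ring,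
      theta_neg, theta_neg]
    ring
  rw [qdetScalar, hprod, ← P.g_mul_g hω hζ sqrt hs h2l h4ζ h4 hp hm, Ahat, Ahat]
  ring

end Chain

end EightVertex

end

/-! ### Assembly of the six claims. -/

theorem mainTheorem8 {N : ℕ} (P : EightVertex.Chain N)
    (hω : 0 < P.ω.im) (hζ : P.t1 P.ζ ≠ 0) :
    -- parity relations
    (∀ l : ℂ, P.Regular l → P.Regular (-l) →
      (P.wb (2 * l) ≠ 0 →
        P.A l = (P.wb (2 * l))⁻¹ • (P.wc (2 * l) • P.D l + P.p l • P.D (-l)) ∧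
        P.D l = (P.wb (2 * l))⁻¹ • (P.wc (2 * l) • P.A l + P.p l • P.A (-l))) ∧
      (P.wd (2 * l) ≠ 0 →
        P.B l = (P.wd (2 * l))⁻¹ • (P.wa (2 * l) • P.C l + P.p l • P.C (-l)) ∧
        P.C l = (P.wd (2 * l))⁻¹ • (P.wa (2 * l) • P.B l + P.p l • P.B (-l)))) ∧
    -- the four expressions of `p` through the entries of `K₋`
    (∀ l : ℂ,
      (P.Kminus (-l) 0 0 ≠ 0 →
        P.p l = (-P.wc (2 * l) * P.Kminus l 0 0 + P.wb (2 * l) * P.Kminus l 1 1) /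
          P.Kminus (-l) 0 0) ∧
      (P.Kminus (-l) 1 1 ≠ 0 →
        P.p l = (-P.wc (2 * l) * P.Kminus l 1 1 + P.wb (2 * l) * P.Kminus l 0 0) /
          P.Kminus (-l) 1 1) ∧
      (P.Regular l → P.Regular (-l) → P.Kminus (-l) 0 1 ≠ 0 →
        P.p l = (-P.wa (2 * l) * P.Kminus l 0 1 + P.wd (2 * l) * P.Kminus l 1 0) /
          P.Kminus (-l) 0 1) ∧
      (P.Regular l → P.Regular (-l) → P.Kminus (-l) 1 0 ≠ 0 →
        P.p l = (-P.wa (2 * l) * P.Kminus l 1 0 + P.wd (2 * l) * P.Kminus l 0 1) /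
          P.Kminus (-l) 1 0)) ∧
    -- the representations of the quantum determinant
    (∀ l : ℂ, P.Regular (l + P.η / 2) → P.Regular (P.η / 2 - l) →
      ∀ ε : ℂ, ε = 1 ∨ ε = -1 →
        P.qdetOverP l =
          P.A (ε * l + P.η / 2) * P.A (P.η / 2 - ε * l) +
            P.B (ε * l + P.η / 2) * P.C (P.η / 2 - ε * l) ∧
        P.qdetOverP l =
          P.D (ε * l + P.η / 2) * P.D (P.η / 2 - ε * l) +
            P.C (ε * l + P.η / 2) * P.B (P.η / 2 - ε * l)) ∧
    -- the inverse of the boundary monodromy matrix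
    (∀ l : ℂ, P.Regular (l + P.η / 2) → P.Regular (P.η / 2 - l) → P.qdet l ≠ 0 →
      IsUnit (P.qdet l) ∧ IsUnit (P.U (l + P.η / 2)) ∧
      (P.U (l + P.η / 2))⁻¹ =
        P.p (l - P.η / 2) •
          (((1 : Matrix (Fin 2) (Fin 2) ℂ) ⊗ₖ (P.qdet l)⁻¹) * P.U (P.η / 2 - l))) ∧
    -- the quantum determinant is central
    (∀ l m : ℂ, P.Regular (l + P.η / 2) → P.Regular (P.η / 2 - l) → P.Regular m →
      Commute (P.qdet l) (P.A m) ∧ Commute (P.qdet l) (P.B m) ∧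
      Commute (P.qdet l) (P.C m) ∧ Commute (P.qdet l) (P.D m)) ∧
    -- its explicit expression, for every branch of the square root and away from the poles
    -- of the functions in `g₋(±λ+η/2)`
    (∀ sqrt : ℂ → ℂ, (∀ z, sqrt z ^ 2 = z) →
      ∀ l : ℂ, P.Regular (l + P.η / 2) → P.Regular (P.η / 2 - l) →
        P.t4 P.ζ ≠ 0 → P.t4 l ≠ 0 → P.t4 (l + P.ζ) ≠ 0 → P.t4 (l - P.ζ) ≠ 0 →
        P.qdet l =
          (P.p (l - P.η / 2) * P.Ahat sqrt (l + P.η / 2) * P.Ahat sqrt (-l + P.η / 2)) •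
            (1 : EightVertex.ChainOp N)) := by
  refine ⟨fun l hl hl' => ?_, fun l => ?_, fun l _ _ ε hε => ?_, fun l _ _ h => ?_,
    fun l m _ _ _ => ?_, fun sqrt hs l h2l _ h4ζ h4 hp hm => ?_⟩
  · have h := P.parityMap_U hω hζ hl hl'
    have h00 : P.wb (2 * l) • P.D l - P.wc (2 * l) • P.A l = P.p l • P.A (-l) :=
      congrFun₂ h 0 0
    have h01 : P.wd (2 * l) • P.C l - P.wa (2 * l) • P.B l = P.p l • P.B (-l) :=
      congrFun₂ h 0 1
    have h10 : P.wd (2 * l) • P.B l - P.wa (2 * l) • P.C l = P.p l • P.C (-l) :=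
      congrFun₂ h 1 0
    have h11 : P.wb (2 * l) • P.A l - P.wc (2 * l) • P.D l = P.p l • P.D (-l) :=
      congrFun₂ h 1 1
    -- Substituting for the terms at -l cancels the c or a term and leaves the weight b or d times
    -- the operator itself.
    rw [← h00, ← h01, ← h10, ← h11]
    simp only [add_sub_cancel]
    exact ⟨fun hb => ⟨(inv_smul_smul₀ hb _).symm, (inv_smul_smul₀ hb _).symm⟩,
      fun hd => ⟨(inv_smul_smul₀ hd _).symm, (inv_smul_smul₀ hd _).symm⟩⟩
  · refine ⟨fun h => ?_, fun h => ?_, fun hl hl' h => ?_, fun hl hl' h => ?_⟩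
    · rw [eq_div_iff h, P.p_mul_Kminus_00 hω hζ]
      ring
    · rw [eq_div_iff h, P.p_mul_Kminus_11 hω hζ]
      ring
    · rw [eq_div_iff h, P.p_mul_Kminus_01 hω hζ hl hl']
      ring
    · rw [eq_div_iff h, P.p_mul_Kminus_10 hω hζ hl hl']
      ring
  · rw [EightVertex.Chain.qdetOverP, P.A_mul_A_add_B_mul_C hω hζ]
    rcases hε with rfl | rfl
    · rw [one_mul, P.A_mul_A_add_B_mul_C hω hζ, P.D_mul_D_add_C_mul_B hω hζ]
      exact ⟨rfl, rfl⟩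
    · rw [neg_one_mul, P.A_mul_A_add_B_mul_C hω hζ, P.D_mul_D_add_C_mul_B hω hζ,
        P.qdetScalar_neg]
      exact ⟨rfl, rfl⟩
  · rw [P.qdet_eq hω hζ] at h ⊢
    have hc : P.p (l - P.η / 2) * P.qdetScalar l ≠ 0 := left_ne_zero_of_smul h
    have hS : P.qdetScalar l ≠ 0 := right_ne_zero_of_mul hc
    have hp : P.p (l - P.η / 2) ≠ 0 := left_ne_zero_of_mul hc
    -- For finite matrices a right inverse is the inverse, so this one product suffices; the factor
    -- p in the stated formula cancels against the one inside `qdet`.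
    have hU : P.U (l + P.η / 2) * ((P.qdetScalar l)⁻¹ • P.U (P.η / 2 - l)) = 1 := by
      rw [Matrix.mul_smul, P.U_mul_U hω hζ, inv_smul_smul₀ hS]
    have hq : ((P.p (l - P.η / 2) * P.qdetScalar l) • (1 : EightVertex.ChainOp N)) *
        ((P.p (l - P.η / 2) * P.qdetScalar l)⁻¹ • 1) = 1 := by
      rw [Matrix.mul_smul, mul_one, inv_smul_smul₀ hc]
    refine ⟨IsUnit.of_mul_eq_one _ hq, IsUnit.of_mul_eq_one _ hU, ?_⟩
    rw [Matrix.inv_eq_right_inv hU, Matrix.inv_eq_right_inv hq, Matrix.kronecker_smul,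
      Matrix.one_kronecker_one, Matrix.smul_mul, one_mul, smul_smul, mul_inv,
      mul_inv_cancel_left₀ hp]
  · rw [P.qdet_eq hω hζ]
    exact ⟨(Commute.one_left _).smul_left _, (Commute.one_left _).smul_left _,
      (Commute.one_left _).smul_left _, (Commute.one_left _).smul_left _⟩
  · have h2l' : P.t4 (2 * l) ≠ 0 := by
      rwa [EightVertex.Chain.Regular, show 2 * (l + P.η / 2) - P.η = 2 * l by ring] at h2l
    rw [P.qdet_eq hω hζ, P.qdetScalar_eq hω hζ sqrt hs h2l' h4ζ h4 hp hm, mul_assoc]
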